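/- Let $n\ge 1$, let $\mathbf m=(m_1,\dots,m_n)$ be a vector of positive integers, and put $m=m_1+\cdots+m_n$. Let $\mathcal Q_{\mathbf m}$ be the set of generalized Stirling permutations of the multiset $\{1^{m_1},\dots,n^{m_n}\}$, that is, of the permutations $\pi=\pi_1\cdots\pi_m$ of this multiset such that, for each $k\in[n]=\{1,\dots,n\}$, no entry between two occurrences of $k$ is smaller than $k$. Put $\pi_0=\pi_{m+1}=0$. Let $\mathrm{asc}(\pi)$, $\mathrm{des}(\pi)$, $\mathrm{plat}(\pi)$ be the numbers of indices $0\le i\le m$ with $\pi_i<\pi_{i+1}$, $\pi_i>\pi_{i+1}$, $\pi_i=\pi_{i+1}$, respectively. A letter $k$ is multiple if $m_k>1$ and single otherwise. Call an index $i\in[m]=\{1,\dots,m\}$ - a single double-descent if $\pi_{i-1}>\pi_i>\pi_{i+1}$ and $\pi_i$ is single; - a multiple descent if $\pi_i>\pi_{i+1}$ and $\pi_i$ is multiple; - a peak if $\pi_{i-1}<\pi_i>\pi_{i+1}$; - an ascent-plateau if $\pi_{i-1}<\pi_i=\pi_{i+1}$; - a free descent-plateau if $\pi_{i-1}>\pi_i=\pi_{i+1}$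 and $\pi_\ell\ne\pi_i$ for all $1\le\ell<i$; - an unmovable plateau if $\pi_i=\pi_{i+1}$ and $i$ is neither a free descent-plateau nor an ascent-plateau. Let $\mathrm{sddes}(\pi)$ and $\mathrm{fdesp}(\pi)$ be the numbers of single double-descents and of free descent-plateaux of $\pi$, let $\mathrm{ascpp}(\pi)$ be the number of indices that are ascent-plateaux or peaks, and let $\mathrm{mdup}(\pi)$ be the number of indices that are multiple descents or unmovable plateaux. A bivariate polynomial $h(x,y)$ is homogeneous $\gamma$-positive if, for some $d\ge0$, it is homogeneous of degree $d$ and $h(x,1)=\sum_{k=0}^{\lfloor d/2\rfloor}\gamma_k x^k(1+x)^{d-2k}$ with all $\gamma_k\ge 0$. A polynomial $p(x,y,z)=\sum_i s_i(x,y)z^i$ is partial $\gamma$-positive if every $s_i(x,y)$ is homogeneous $\gamma$-positive. **Theorem.** The polynomial $$S_{\mathbf m}(x,y,z)=\sum_{\pi\in\mathcal Q_{\mathbf m}}x^{\mathrm{asc}(\pi)}y^{\mathrm{des}(\pi)}z^{\mathrm{plat}(\pi)}$$ is partial $\gamma$-positive and has the expansion $$S_{\mathbf m}(x,y,z)=\sum_{i=0}^{m-1}z^i\sum_{j=1}^{\lfloor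 (m+1-i)/2\rfloor}\gamma_{\mathbf m,i,j}\,(xy)^j(x+y)^{m+1-i-2j},$$ where $$\gamma_{\mathbf m,i,j}=\#\{\pi\in\mathcal Q_{\mathbf m}:\ \mathrm{sddes}(\pi)=\mathrm{fdesp}(\pi)=0,\ \mathrm{mdup}(\pi)=i,\ \mathrm{ascpp}(\pi)=j\}.$$ -/

import Mathlib

/-! ### Words and their statistics

A word `w = w_1 ⋯ w_m` over the positive integers is a `List ℕ`. -/

namespace GenStirling

/-- The `i`-th letter `w_i` of `w = w_1 ⋯ w_m` (numbered from `1`), with the convention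
`w_0 = w_{m+1} = 0`. -/
def letter (w : List ℕ) (i : ℕ) : ℕ := (0 :: w).getD i 0

/-- The number of ascents: indices `0 ≤ i ≤ m` with `w_i < w_{i+1}`. -/
def asc (w : List ℕ) : ℕ :=
  ((Finset.range (w.length + 1)).filter fun i => letter w i < letter w (i + 1)).card

/-- The number of descents: indices `0 ≤ i ≤ m` with `w_i > w_{i+1}`. -/
def des (w : List ℕ) : ℕ :=
  ((Finset.range (w.length + 1)).filter fun i => letter w (i + 1) < letter w i).card

/-- The number of plateaux: indices `0 ≤ i ≤ m` with `w_i = w_{i+1}`. -/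
def plat (w : List ℕ) : ℕ :=
  ((Finset.range (w.length + 1)).filter fun i => letter w i = letter w (i + 1)).card

/-- The letter `k` is multiple in `w`: it occurs more than once. In a permutation of the multiset
`{1^{m_1}, …, n^{m_n}}` this says `m_k > 1`. -/
abbrev IsMultiple (w : List ℕ) (k : ℕ) : Prop := 1 < w.count k

/-- `w_{i-1} > w_i > w_{i+1}` and the letter `w_i` is single. -/
abbrev IsSingleDoubleDescent (w : List ℕ) (i : ℕ) : Prop :=
  letter w i < letter w (i - 1) ∧ letter w (i + 1) < letter w i ∧ ¬ IsMultiple w (letter w i)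

/-- `w_i > w_{i+1}` and the letter `w_i` is multiple. -/
abbrev IsMultipleDescent (w : List ℕ) (i : ℕ) : Prop :=
  letter w (i + 1) < letter w i ∧ IsMultiple w (letter w i)

/-- `w_{i-1} < w_i > w_{i+1}`. -/
abbrev IsPeak (w : List ℕ) (i : ℕ) : Prop :=
  letter w (i - 1) < letter w i ∧ letter w (i + 1) < letter w i

/-- `w_{i-1} < w_i = w_{i+1}`. -/
abbrev IsAscentPlateau (w : List ℕ) (i : ℕ) : Prop :=
  letter w (i - 1) < letter w i ∧ letter w i = letter w (i + 1)

/-- `w_{i-1} > w_i = w_{i+1}`, and `w_l ≠ w_i` for all `1 ≤ l < i`. -/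
abbrev IsFreeDescentPlateau (w : List ℕ) (i : ℕ) : Prop :=
  letter w i < letter w (i - 1) ∧ letter w i = letter w (i + 1) ∧
    ∀ l ∈ Finset.Ico 1 i, letter w l ≠ letter w i

/-- `w_i = w_{i+1}`, and `i` is neither a free descent-plateau nor an ascent-plateau. -/
abbrev IsUnmovablePlateau (w : List ℕ) (i : ℕ) : Prop :=
  letter w i = letter w (i + 1) ∧ ¬ IsFreeDescentPlateau w i ∧ ¬ IsAscentPlateau w i

/-- The number of single double-descents `i ∈ [m]`. -/
def sddes (w : List ℕ) : ℕ :=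
  ((Finset.Icc 1 w.length).filter fun i => IsSingleDoubleDescent w i).card

/-- The number of free descent-plateaux `i ∈ [m]`. -/
def fdesp (w : List ℕ) : ℕ :=
  ((Finset.Icc 1 w.length).filter fun i => IsFreeDescentPlateau w i).card

/-- The number of `i ∈ [m]` that are ascent-plateaux or peaks. -/
def ascpp (w : List ℕ) : ℕ :=
  ((Finset.Icc 1 w.length).filter fun i => IsAscentPlateau w i ∨ IsPeak w i).card

/-- The number of `i ∈ [m]` that are multiple descents or unmovable plateaux. -/
def mdup (w : List ℕ) : ℕ :=
  ((Finset.Icc 1 w.length).filter fun i => IsMultipleDescent w i ∨ IsUnmovablePlateau w i).card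

/-! ### Generalized Stirling permutations -/

/-- No letter standing between two occurrences of `a` is smaller than `a`
(`[a, b, a]` is a subsequence of `w` iff `b` occurs between two occurrences of `a`). -/
abbrev IsStirling (w : List ℕ) : Prop :=
  ∀ a ∈ w, ∀ b ∈ w, List.Sublist [a, b, a] w → a ≤ b

/-- The multiset `{1^{m_1}, 2^{m_2}, …, n^{m_n}}`; `m_k` is `m (k - 1)` with `Fin n = {0, …, n-1}`. -/
def letters {n : ℕ} (m : Fin n → ℕ) : Multiset ℕ :=
  ∑ k : Fin n, Multiset.replicate (m k) ((k : ℕ) + 1)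

/-- The set `Q_m` of generalized Stirling permutations of `{1^{m_1}, …, n^{m_n}}`. -/
def stirlingPerms {n : ℕ} (m : Fin n → ℕ) : Finset (List ℕ) :=
  (letters m).lists.toFinset.filter fun w => IsStirling w

/-- `S_m(x,y,z) = ∑_{π ∈ Q_m} x^{asc π} y^{des π} z^{plat π}`, with `x = X 0`, `y = X 1`,
`z = X 2`. -/
noncomputable def stirlingPoly {n : ℕ} (m : Fin n → ℕ) : MvPolynomial (Fin 3) ℤ :=
  ∑ w ∈ stirlingPerms m,
    MvPolynomial.X 0 ^ asc w * MvPolynomial.X 1 ^ des w * MvPolynomial.X 2 ^ plat w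

/-- `γ_{m,i,j} = #{π ∈ Q_m : sddes π = fdesp π = 0, mdup π = i, ascpp π = j}`. -/
def gammaCoeff {n : ℕ} (m : Fin n → ℕ) (i j : ℕ) : ℕ :=
  ((stirlingPerms m).filter fun w =>
    sddes w = 0 ∧ fdesp w = 0 ∧ mdup w = i ∧ ascpp w = j).card

/-! ### Gamma-positivity -/

/-- `f(x) = ∑_{k=0}^{⌊d/2⌋} γ_k x^k (1+x)^{d-2k}` with all `γ_k ≥ 0`. -/
def IsGammaPositive (d : ℕ) (f : Polynomial ℤ) : Prop :=
  ∃ γ : ℕ → ℤ, (∀ k, 0 ≤ γ k) ∧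
    f = ∑ k ∈ Finset.range (d / 2 + 1),
      Polynomial.C (γ k) * Polynomial.X ^ k * (1 + Polynomial.X) ^ (d - 2 * k)

/-- `h(x,y)` is homogeneous, of some degree `d`, and `h(x,1)` is gamma-positive with center `d/2`;
equivalently `h = ∑_k γ_k (xy)^k (x+y)^{d-2k}` with all `γ_k ≥ 0`. -/
def IsHomogeneousGammaPositive (h : MvPolynomial (Fin 2) ℤ) : Prop :=
  ∃ d : ℕ, h.IsHomogeneous d ∧
    IsGammaPositive d (MvPolynomial.aeval ![(Polynomial.X : Polynomial ℤ), 1] h)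

/-- `p(x,y,z) = ∑_i s_i(x,y) z^i` where every `s_i` is homogeneous gamma-positive. -/
def IsPartialGammaPositive (p : MvPolynomial (Fin 3) ℤ) : Prop :=
  ∃ s : ℕ →₀ MvPolynomial (Fin 2) ℤ,
    p = s.sum (fun i h => MvPolynomial.rename Fin.castSucc h * MvPolynomial.X 2 ^ i) ∧
    ∀ i, IsHomogeneousGammaPositive (s i)

end GenStirling

/-! All copies of the largest letter of a Stirling permutation are adjacent, so each such word
arises exactly once by inserting the block of `k` copies of that letter into a gap of a Stirling
word in the smaller letters (`sum_stirlingPerms_succ`). Summing a monomial weight over all gaps then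
acts as a derivation, up to a power of `z`.

For `x^asc y^des z^plat` each factor is a gap, and insertion replaces it by `x y z^(k-1)`. This is
`z^(k-1)` times the derivation sending `x`, `y`, `z` to `xy` (`sum_gapWeight_insertBlock`).

The other statistics sort the same gaps differently. An index counted by `ascpp` owns the gaps on
both sides of it, an index counted by `mdup`, `sddes` or `fdesp` owns the gap after it, and the
remaining `r` gaps are neutral. On `u^ascpp z^mdup a^r b^(sddes+fdesp)` insertion is `z^(k-1)` times
the derivation `u ↦ u(a+b)`, `z, a, b ↦ u` (`IsStirling.sum_moveWeight_insertBlock`).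

Both derivations lift to `u ↦ uv`, `v ↦ 2u`, `z ↦ u`, through `u = xy`, `v = x + y` in the first
case and `v = a + b` in the second. Hence one polynomial `G(u,v,z)` yields both generating functions
(`exists_common_polynomial`). Specializing `u = xy`, `a = x + y`, `b = 0` in the second recovers the
first and kills every word with `sddes + fdesp > 0`. The surviving monomials are the terms of the
gamma expansion. -/

namespace GenStirling

/-! ### Insertion of a block of equal letters -/

/-- Insert `k` copies of `N` after the first `g` letters of `w`. -/
def insertBlock (N k : ℕ) (w : List ℕ) (g : ℕ) : List ℕ :=
  w.take g ++ (List.replicate k N ++ w.drop g)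

lemma length_insertBlock (N k : ℕ) (w : List ℕ) (g : ℕ) :
    (insertBlock N k w g).length = w.length + k := by
  simp only [insertBlock, List.length_append, List.length_take, List.length_replicate,
    List.length_drop]
  omega

lemma perm_insertBlock (N k : ℕ) (w : List ℕ) (g : ℕ) :
    (insertBlock N k w g).Perm (List.replicate k N ++ w) := by
  unfold insertBlock
  refine List.perm_append_comm_assoc _ _ _ |>.trans ?_
  rw [List.take_append_drop]

lemma count_insertBlock (N k : ℕ) (w : List ℕ) (g c : ℕ) :
    (insertBlock N k w g).count c = (if N = c then k else 0) + w.count c := by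
  rw [(perm_insertBlock N k w g).count_eq, List.count_append, List.count_replicate]
  simp

lemma letter_zero (w : List ℕ) : letter w 0 = 0 := by simp [letter]

lemma letter_succ (w : List ℕ) (i : ℕ) : letter w (i + 1) = w.getD i 0 := by
  simp [letter]

lemma letter_of_length_lt {w : List ℕ} {i : ℕ} (h : w.length < i) : letter w i = 0 := by
  obtain ⟨j, rfl⟩ : ∃ j, i = j + 1 := ⟨i - 1, by omega⟩
  rw [letter_succ, List.getD_eq_default _ _ (by omega)]

lemma letter_eq_getElem {w : List ℕ} {i : ℕ} (h : i < w.length) : letter w (i + 1) = w[i] := by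
  rw [letter_succ, List.getD_eq_getElem _ _ h]

lemma letter_mem {w : List ℕ} {i : ℕ} (h : 1 ≤ i) (h' : i ≤ w.length) : letter w i ∈ w := by
  obtain ⟨j, rfl⟩ : ∃ j, i = j + 1 := ⟨i - 1, by omega⟩
  rw [letter_eq_getElem h']
  exact List.getElem_mem _

lemma letter_insertBlock_of_le {N k : ℕ} {w : List ℕ} {g i : ℕ} (hg : g ≤ w.length)
    (hi : i ≤ g) : letter (insertBlock N k w g) i = letter w i := by
  rcases i with _ | j
  · simp [letter_zero]
  · rw [letter_succ, letter_succ, insertBlock, List.getD_append _ _ _ _ (by simp; omega)]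
    rw [List.getD_eq_getElem _ _ (by simp; omega), List.getD_eq_getElem _ _ (by omega)]
    simp

lemma letter_insertBlock_block {N k : ℕ} {w : List ℕ} {g j : ℕ} (hg : g ≤ w.length)
    (hj : j < k) : letter (insertBlock N k w g) (g + 1 + j) = N := by
  rw [show g + 1 + j = (g + j) + 1 by omega, letter_succ, insertBlock,
    List.getD_append_right _ _ _ _ (by simp), List.getD_append _ _ _ _ (by simp; omega)]
  rw [List.getD_eq_getElem _ _ (by simp; omega)]
  simp

lemma letter_insertBlock_add {N k : ℕ} {w : List ℕ} {g i : ℕ} (hg : g ≤ w.length)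
    (hi : g < i) : letter (insertBlock N k w g) (i + k) = letter w i := by
  obtain ⟨j, rfl⟩ : ∃ j, i = j + 1 := ⟨i - 1, by omega⟩
  rw [show j + 1 + k = (j + k) + 1 by omega, letter_succ, letter_succ, insertBlock,
    List.getD_append_right _ _ _ _ (by simp; omega),
    List.getD_append_right _ _ _ _ (by simp; omega)]
  simp only [List.length_take, List.length_replicate, List.getD_eq_getElem?_getD,
    List.getElem?_drop]
  congr 2
  omega

/-! ### Counting before and after an insertion -/

/-- Only the two indices around the gap can change status, since the predicates in question look one
letter to either side. The range `m + 2` keeps the index `g + 1` inside even when `g = m`, and the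
additive form avoids truncated subtraction. -/
lemma card_filter_splice (P P' : ℕ → Prop) [DecidablePred P] [DecidablePred P'] {m g k : ℕ}
    (hg : g ≤ m) (hlo : ∀ i < g, (P' i ↔ P i)) (hhi : ∀ i, g + 1 < i → (P' (i + k) ↔ P i)) :
    ((Finset.range (m + k + 2)).filter P').card + (if P g then 1 else 0)
        + (if P (g + 1) then 1 else 0)
      = ((Finset.range (m + 2)).filter P).card + (if P' g then 1 else 0)
        + (if P' (g + 1 + k) then 1 else 0)
        + ((Finset.range k).filter fun j => P' (g + 1 + j)).card := by
  simp only [Finset.card_filter]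
  obtain ⟨d, rfl⟩ : ∃ d, m = g + d := ⟨m - g, by omega⟩
  rw [show g + d + k + 2 = g + 1 + k + 1 + d by omega, show g + d + 2 = g + 1 + 1 + d by omega]
  rw [Finset.sum_range_add _ (g + 1 + k + 1) d, Finset.sum_range_succ _ (g + 1 + k),
    Finset.sum_range_add _ (g + 1) k,
    Finset.sum_range_succ _ g, Finset.sum_range_add _ (g + 1 + 1) d,
    Finset.sum_range_succ _ (g + 1), Finset.sum_range_succ _ g]
  have h1 : ∑ i ∈ Finset.range g, (if P' i then 1 else 0)
      = ∑ i ∈ Finset.range g, (if P i then 1 else 0) :=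
    Finset.sum_congr rfl fun i hi => by simp only [hlo i (Finset.mem_range.1 hi)]
  have h2 : ∑ i ∈ Finset.range d, (if P' (g + 1 + k + 1 + i) then 1 else 0)
      = ∑ i ∈ Finset.range d, (if P (g + 1 + 1 + i) then 1 else 0) :=
    Finset.sum_congr rfl fun i _ => by
      rw [show g + 1 + k + 1 + i = g + 1 + 1 + i + k by omega]
      simp only [hhi (g + 1 + 1 + i) (by omega)]
  rw [h1, h2]
  omega

lemma card_filter_range_eq_zero {k : ℕ} (hk : 0 < k) :
    ((Finset.range k).filter fun j => j = 0).card = 1 := by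
  rw [Finset.filter_eq' (Finset.range k) 0]
  simp [hk]

lemma card_filter_range_ne_zero {k : ℕ} (hk : 0 < k) :
    ((Finset.range k).filter fun j => j ≠ 0).card = k - 1 := by
  rw [Finset.filter_ne' (Finset.range k) 0, Finset.card_erase_of_mem (by simpa using hk)]
  simp

lemma card_filter_range_succ_eq {k : ℕ} (hk : 0 < k) :
    ((Finset.range k).filter fun j => j + 1 = k).card = 1 := by
  have : ((Finset.range k).filter fun j => j + 1 = k) = {k - 1} := by
    ext j; simp; omega
  rw [this]; rfl

lemma card_filter_range_succ_ne {k : ℕ} :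
    ((Finset.range k).filter fun j => j + 1 ≠ k).card = k - 1 := by
  have : ((Finset.range k).filter fun j => j + 1 ≠ k) = Finset.range (k - 1) := by
    ext j; simp; omega
  rw [this]; simp

/-! ### Ascents, descents and plateaux under insertion -/

lemma card_filter_range_succ_eq_filter_le (P : ℕ → Prop) [DecidablePred P] (m : ℕ) :
    ((Finset.range (m + 1)).filter P).card
      = ((Finset.range (m + 2)).filter fun i => i ≤ m ∧ P i).card := by
  congr 1
  ext i
  simp only [Finset.mem_filter, Finset.mem_range, ← and_assoc]
  refine and_congr_left fun _ => ?_
  omega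

lemma letter_lt {N : ℕ} {w : List ℕ} (hN : ∀ x ∈ w, x < N) (hN0 : 0 < N) (i : ℕ) :
    letter w i < N := by
  rcases i with _ | j
  · simpa [letter_zero]
  · by_cases h : j + 1 ≤ w.length
    · exact hN _ (letter_mem (by omega) h)
    · rwa [letter_of_length_lt (by omega)]

lemma letter_insertBlock_block_succ {N k : ℕ} {w : List ℕ} {g j : ℕ} (hg : g ≤ w.length)
    (hj : j < k) : letter (insertBlock N k w g) (g + 1 + j + 1)
      = if j + 1 = k then letter w (g + 1) else N := by
  split_ifs with h
  · rw [show g + 1 + j + 1 = g + 1 + k by omega, letter_insertBlock_add hg (by omega)]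
  · exact letter_insertBlock_block (j := j + 1) hg (by omega)

/-- The adjacent pair across the gap gives way to one pair entering the block, `k - 1` pairs inside
it and one pair leaving it. Ascents, descents and plateaux are the cases `<`, `>` and `=`. -/
lemma card_filter_rel_insertBlock (r : ℕ → ℕ → Prop) [DecidableRel r] {N k : ℕ} {w : List ℕ}
    {g : ℕ} (hk : 0 < k) (hg : g ≤ w.length) :
    ((Finset.range ((insertBlock N k w g).length + 1)).filter fun i =>
        r (letter (insertBlock N k w g) i) (letter (insertBlock N k w g) (i + 1))).card
        + (if r (letter w g) (letter w (g + 1)) then 1 else 0)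
      = ((Finset.range (w.length + 1)).filter fun i => r (letter w i) (letter w (i + 1))).card
        + (if r (letter w g) N then 1 else 0)
        + ((Finset.range k).filter fun j =>
            r N (if j + 1 = k then letter w (g + 1) else N)).card := by
  rw [length_insertBlock, card_filter_range_succ_eq_filter_le _ (w.length + k),
    card_filter_range_succ_eq_filter_le _ w.length]
  have h := card_filter_splice (fun i => i ≤ w.length ∧ r (letter w i) (letter w (i + 1)))
    (fun i => i ≤ w.length + k ∧ r (letter (insertBlock N k w g) i)
      (letter (insertBlock N k w g) (i + 1))) (k := k) hg
    (fun i hi => by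
      rw [letter_insertBlock_of_le hg (by omega), letter_insertBlock_of_le hg (by omega)]
      simp only [show i ≤ w.length by omega, show i ≤ w.length + k by omega])
    (fun i hi => by
      rw [show i + k + 1 = i + 1 + k by omega, letter_insertBlock_add hg (by omega),
        letter_insertBlock_add hg (by omega)]
      simp)
  have h1 : letter (insertBlock N k w g) (g + 1) = N := letter_insertBlock_block (j := 0) hg hk
  have h2 : letter (insertBlock N k w g) (g + 1 + k + 1) = letter w (g + 1 + 1) := by
    rw [show g + 1 + k + 1 = g + 1 + 1 + k by omega, letter_insertBlock_add hg (by omega)]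
  have h3 : ((Finset.range k).filter fun j => g + 1 + j ≤ w.length + k ∧
        r (letter (insertBlock N k w g) (g + 1 + j))
          (letter (insertBlock N k w g) (g + 1 + j + 1)))
      = ((Finset.range k).filter fun j =>
            r N (if j + 1 = k then letter w (g + 1) else N)) := by
    refine Finset.filter_congr fun j hj => ?_
    have hj := Finset.mem_range.1 hj
    rw [letter_insertBlock_block hg hj, letter_insertBlock_block_succ hg hj]
    simp only [show g + 1 + j ≤ w.length + k by omega, true_and]
  rw [h3] at h
  simp only [h1, h2, letter_insertBlock_of_le hg le_rfl,
    letter_insertBlock_add (k := k) (N := N) hg (Nat.lt_add_one g),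
    show g ≤ w.length + k by omega, hg, true_and,
    show g + 1 + k ≤ w.length + k ↔ g + 1 ≤ w.length by omega] at h
  omega

lemma asc_insertBlock {N k : ℕ} {w : List ℕ} {g : ℕ} (hk : 0 < k) (hg : g ≤ w.length)
    (hN : ∀ x ∈ w, x < N) (hN0 : 0 < N) :
    asc (insertBlock N k w g) + (if letter w g < letter w (g + 1) then 1 else 0)
      = asc w + 1 := by
  have h := card_filter_rel_insertBlock (fun x y => x < y) (N := N) hk hg
  have h3 : ((Finset.range k).filter fun j =>
      N < (if j + 1 = k then letter w (g + 1) else N)) = ∅ := by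
    refine Finset.filter_eq_empty_iff.2 fun j _ => ?_
    have := letter_lt hN hN0 (g + 1)
    split_ifs <;> omega
  rw [h3, if_pos (letter_lt hN hN0 g)] at h
  simpa [asc] using h

lemma des_insertBlock {N k : ℕ} {w : List ℕ} {g : ℕ} (hk : 0 < k) (hg : g ≤ w.length)
    (hN : ∀ x ∈ w, x < N) (hN0 : 0 < N) :
    des (insertBlock N k w g) + (if letter w (g + 1) < letter w g then 1 else 0)
      = des w + 1 := by
  have h := card_filter_rel_insertBlock (fun x y => y < x) (N := N) hk hg
  have h3 : ((Finset.range k).filter fun j =>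
      (if j + 1 = k then letter w (g + 1) else N) < N)
        = (Finset.range k).filter fun j => j + 1 = k := by
    refine Finset.filter_congr fun j _ => ?_
    have := letter_lt hN hN0 (g + 1)
    split_ifs with h <;> simp [h, this]
  rw [h3, if_neg (letter_lt hN hN0 g).not_gt, card_filter_range_succ_eq hk] at h
  simpa [des] using h

lemma plat_insertBlock {N k : ℕ} {w : List ℕ} {g : ℕ} (hk : 0 < k) (hg : g ≤ w.length)
    (hN : ∀ x ∈ w, x < N) (hN0 : 0 < N) :
    plat (insertBlock N k w g) + (if letter w g = letter w (g + 1) then 1 else 0)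
      = plat w + (k - 1) := by
  have h := card_filter_rel_insertBlock (fun x y => x = y) (N := N) hk hg
  have h3 : ((Finset.range k).filter fun j =>
      N = (if j + 1 = k then letter w (g + 1) else N))
        = (Finset.range k).filter fun j => j + 1 ≠ k := by
    refine Finset.filter_congr fun j _ => ?_
    have := letter_lt hN hN0 (g + 1)
    split_ifs with h <;> simp [h, this.ne']
  rw [h3, if_neg (letter_lt hN hN0 g).ne, card_filter_range_succ_ne] at h
  simpa [plat] using h

end GenStirling
namespace GenStirling

/-! ### Movable and fixed indices -/

/-- No letter before the `i`-th one is equal to it. -/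
abbrev IsFirst (w : List ℕ) (i : ℕ) : Prop :=
  ∀ l ∈ Finset.Ico 1 i, letter w l ≠ letter w i

/-- The `i`-th letter is single and followed by a descent, or it is a first occurrence followed
by a plateau. -/
def IsMovable (w : List ℕ) (i : ℕ) : Prop :=
  (1 ≤ i ∧ i ≤ w.length) ∧ ((letter w (i + 1) < letter w i ∧ ¬ IsMultiple w (letter w i)) ∨
    (letter w i = letter w (i + 1) ∧ IsFirst w i))

instance (w : List ℕ) : DecidablePred (IsMovable w) := fun i => by
  unfold IsMovable
  infer_instance

/-- The `i`-th letter is multiple and followed by a descent, or it is a repeated occurrence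
followed by a plateau. -/
def IsFixed (w : List ℕ) (i : ℕ) : Prop :=
  (1 ≤ i ∧ i ≤ w.length) ∧ ((letter w (i + 1) < letter w i ∧ IsMultiple w (letter w i)) ∨
    (letter w i = letter w (i + 1) ∧ ¬ IsFirst w i))

instance (w : List ℕ) : DecidablePred (IsFixed w) := fun i => by
  unfold IsFixed
  infer_instance

/-- A movable index preceded by an ascent. -/
def IsTop (w : List ℕ) (i : ℕ) : Prop := IsMovable w i ∧ letter w (i - 1) < letter w i

instance (w : List ℕ) : DecidablePred (IsTop w) := fun i => by
  unfold IsTop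
  infer_instance

/-- A movable index preceded by a descent. -/
def IsFall (w : List ℕ) (i : ℕ) : Prop := IsMovable w i ∧ letter w i < letter w (i - 1)

instance (w : List ℕ) : DecidablePred (IsFall w) := fun i => by
  unfold IsFall
  infer_instance

lemma not_movable_and_fixed {w : List ℕ} {i : ℕ} (h : IsMovable w i) : ¬ IsFixed w i := by
  rintro ⟨-, h'⟩
  rcases h with ⟨-, ⟨h1, h2⟩ | ⟨h1, h2⟩⟩ <;> rcases h' with ⟨h3, h4⟩ | ⟨h3, h4⟩
  · exact h2 h4
  · omega
  · omega
  · exact h4 h2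

lemma IsMovable.letter_succ_le {w : List ℕ} {i : ℕ} (h : IsMovable w i) :
    letter w (i + 1) ≤ letter w i := by
  rcases h with ⟨-, ⟨h1, h2⟩ | ⟨h1, h2⟩⟩ <;> omega

lemma IsFixed.letter_succ_le {w : List ℕ} {i : ℕ} (h : IsFixed w i) :
    letter w (i + 1) ≤ letter w i := by
  rcases h with ⟨-, ⟨h1, h2⟩ | ⟨h1, h2⟩⟩ <;> omega

lemma isFirst_insertBlock_of_le {N k : ℕ} {w : List ℕ} {g i : ℕ} (hg : g ≤ w.length)
    (hi : i ≤ g) : IsFirst (insertBlock N k w g) i ↔ IsFirst w i := by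
  refine forall₂_congr fun l hl => ?_
  have := (Finset.mem_Ico.1 hl).2
  rw [letter_insertBlock_of_le hg (by omega), letter_insertBlock_of_le hg hi]

lemma isFirst_insertBlock_add {N k : ℕ} {w : List ℕ} {g i : ℕ} (hg : g ≤ w.length)
    (hi : g < i) (hN : letter w i < N) :
    IsFirst (insertBlock N k w g) (i + k) ↔ IsFirst w i := by
  unfold IsFirst
  rw [letter_insertBlock_add hg hi]
  constructor
  · intro h l hl
    rw [Finset.mem_Ico] at hl
    by_cases hlg : l ≤ g
    · have := h l (Finset.mem_Ico.2 (by omega))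
      rwa [letter_insertBlock_of_le hg hlg] at this
    · have := h (l + k) (Finset.mem_Ico.2 (by omega))
      rwa [letter_insertBlock_add hg (by omega)] at this
  · intro h l hl
    rw [Finset.mem_Ico] at hl
    by_cases hlg : l ≤ g
    · rw [letter_insertBlock_of_le hg hlg]
      exact h l (Finset.mem_Ico.2 (by omega))
    · by_cases hlk : l ≤ g + k
      · have := letter_insertBlock_block (N := N) (w := w) (j := l - (g + 1)) (k := k) hg (by omega)
        rw [show g + 1 + (l - (g + 1)) = l by omega] at this
        omega
      · have := h (l - k) (Finset.mem_Ico.2 (by omega))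
        rwa [← letter_insertBlock_add (N := N) (k := k) hg (by omega),
          show l - k + k = l by omega] at this

lemma isFirst_insertBlock_block {N k : ℕ} {w : List ℕ} {g j : ℕ} (hg : g ≤ w.length)
    (hN : ∀ x ∈ w, x < N) (hN0 : 0 < N) (hj : j < k) :
    IsFirst (insertBlock N k w g) (g + 1 + j) ↔ j = 0 := by
  unfold IsFirst
  rw [letter_insertBlock_block hg hj]
  constructor
  · intro h
    by_contra hj0
    exact h (g + 1 + 0) (Finset.mem_Ico.2 (by omega)) (letter_insertBlock_block hg (by omega))
  · rintro rfl l hl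
    rw [Finset.mem_Ico] at hl
    rw [letter_insertBlock_of_le hg (by omega)]
    exact (letter_lt hN hN0 l).ne

lemma isMultiple_insertBlock {N k : ℕ} {w : List ℕ} {g c : ℕ} (hc : c < N) :
    IsMultiple (insertBlock N k w g) c ↔ IsMultiple w c := by
  unfold IsMultiple
  rw [count_insertBlock, if_neg hc.ne', zero_add]

lemma isMultiple_insertBlock_self {N k : ℕ} {w : List ℕ} {g : ℕ} (hN : ∀ x ∈ w, x < N) :
    IsMultiple (insertBlock N k w g) N ↔ 1 < k := by
  unfold IsMultiple
  rw [count_insertBlock, if_pos rfl, List.count_eq_zero_of_not_mem fun h => (hN N h).false]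
  simp

/-! ### Movable and fixed indices under insertion. -/

section Insert

variable {N k : ℕ} {w : List ℕ} {g : ℕ} (hg : g ≤ w.length) (hN : ∀ x ∈ w, x < N) (hN0 : 0 < N)
  (hk : 0 < k)

include hg hN hN0

lemma isMovable_insertBlock_of_lt {i : ℕ} (hi : i < g) :
    IsMovable (insertBlock N k w g) i ↔ IsMovable w i := by
  unfold IsMovable
  rw [letter_insertBlock_of_le hg (by omega), letter_insertBlock_of_le hg (by omega),
    isFirst_insertBlock_of_le hg hi.le, isMultiple_insertBlock (letter_lt hN hN0 i),
    length_insertBlock]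
  refine and_congr_left fun _ => ?_
  omega

lemma isFixed_insertBlock_of_lt {i : ℕ} (hi : i < g) :
    IsFixed (insertBlock N k w g) i ↔ IsFixed w i := by
  unfold IsFixed
  rw [letter_insertBlock_of_le hg (by omega), letter_insertBlock_of_le hg (by omega),
    isFirst_insertBlock_of_le hg hi.le, isMultiple_insertBlock (letter_lt hN hN0 i),
    length_insertBlock]
  refine and_congr_left fun _ => ?_
  omega

lemma isMovable_insertBlock_add {i : ℕ} (hi : g < i) :
    IsMovable (insertBlock N k w g) (i + k) ↔ IsMovable w i := by
  unfold IsMovable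
  rw [show i + k + 1 = i + 1 + k by omega, letter_insertBlock_add hg (by omega),
    letter_insertBlock_add hg (by omega), isFirst_insertBlock_add hg hi (letter_lt hN hN0 i),
    isMultiple_insertBlock (letter_lt hN hN0 i), length_insertBlock]
  refine and_congr_left fun _ => ?_
  omega

lemma isFixed_insertBlock_add {i : ℕ} (hi : g < i) :
    IsFixed (insertBlock N k w g) (i + k) ↔ IsFixed w i := by
  unfold IsFixed
  rw [show i + k + 1 = i + 1 + k by omega, letter_insertBlock_add hg (by omega),
    letter_insertBlock_add hg (by omega), isFirst_insertBlock_add hg hi (letter_lt hN hN0 i),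
    isMultiple_insertBlock (letter_lt hN hN0 i), length_insertBlock]
  refine and_congr_left fun _ => ?_
  omega

/-- For `k = 1` the block is a single letter followed by a descent; for `k > 1` its first letter is
a first occurrence followed by a plateau. Every later letter is a repeat on a plateau or the final
descent of a multiple letter. -/
lemma isMovable_insertBlock_block {j : ℕ} (hj : j < k) :
    IsMovable (insertBlock N k w g) (g + 1 + j) ↔ j = 0 := by
  unfold IsMovable
  rw [letter_insertBlock_block hg hj, letter_insertBlock_block_succ hg hj,
    isFirst_insertBlock_block hg hN hN0 hj, isMultiple_insertBlock_self hN, length_insertBlock]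
  have := letter_lt hN hN0 (g + 1)
  split_ifs <;> omega

lemma isFixed_insertBlock_block {j : ℕ} (hj : j < k) :
    IsFixed (insertBlock N k w g) (g + 1 + j) ↔ j ≠ 0 := by
  unfold IsFixed
  rw [letter_insertBlock_block hg hj, letter_insertBlock_block_succ hg hj,
    isFirst_insertBlock_block hg hN hN0 hj, isMultiple_insertBlock_self hN, length_insertBlock]
  have := letter_lt hN hN0 (g + 1)
  split_ifs <;> omega

include hk

lemma letter_insertBlock_lt_succ :
    letter (insertBlock N k w g) g < letter (insertBlock N k w g) (g + 1) := by
  have h : letter (insertBlock N k w g) (g + 1) = N := letter_insertBlock_block (j := 0) hg hk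
  rw [h, letter_insertBlock_of_le hg le_rfl]
  exact letter_lt hN hN0 g

lemma not_isMovable_insertBlock : ¬ IsMovable (insertBlock N k w g) g := fun h =>
  (letter_insertBlock_lt_succ hg hN hN0 hk).not_ge h.letter_succ_le

lemma not_isFixed_insertBlock : ¬ IsFixed (insertBlock N k w g) g := fun h =>
  (letter_insertBlock_lt_succ hg hN hN0 hk).not_ge h.letter_succ_le

lemma letter_insertBlock_add_lt_pred :
    letter (insertBlock N k w g) (g + 1 + k) < letter (insertBlock N k w g) (g + 1 + k - 1) := by
  rw [letter_insertBlock_add hg (by omega), show g + 1 + k - 1 = g + 1 + (k - 1) by omega,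
    letter_insertBlock_block hg (by omega)]
  exact letter_lt hN hN0 _

/-- The first letter of the block is a new top. The letter before the gap now precedes an ascent and
the letter after it now follows a descent, so neither can remain a top. -/
lemma card_isTop_insertBlock :
    ((Finset.range (w.length + k + 2)).filter fun i => IsTop (insertBlock N k w g) i).card
        + (if IsTop w g then 1 else 0) + (if IsTop w (g + 1) then 1 else 0)
      = ((Finset.range (w.length + 2)).filter fun i => IsTop w i).card + 1 := by
  rw [card_filter_splice (fun i => IsTop w i) (fun i => IsTop (insertBlock N k w g) i) hg]
  · rw [if_neg fun h => not_isMovable_insertBlock hg hN hN0 hk h.1,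
      if_neg fun h => (letter_insertBlock_add_lt_pred hg hN hN0 hk).not_gt h.2,
      add_zero, add_zero]
    refine congrArg _ (Eq.trans (congrArg _ ?_) (card_filter_range_eq_zero hk))
    refine Finset.filter_congr fun j hj => ?_
    have hj := Finset.mem_range.1 hj
    unfold IsTop
    rw [isMovable_insertBlock_block hg hN hN0 hj]
    refine and_iff_left_of_imp ?_
    rintro rfl
    exact letter_insertBlock_lt_succ hg hN hN0 hk
  · intro i hi
    unfold IsTop
    rw [isMovable_insertBlock_of_lt hg hN hN0 hi, letter_insertBlock_of_le hg (by omega),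
      letter_insertBlock_of_le hg (by omega)]
  · intro i hi
    unfold IsTop
    rw [isMovable_insertBlock_add hg hN hN0 (by omega), letter_insertBlock_add hg (by omega),
      show i + k - 1 = i - 1 + k by omega, letter_insertBlock_add hg (by omega)]

/-- After insertion the letter behind the gap follows the larger letter `N`, so if movable it is a
fall: a former top is gained, a former fall is kept. Here `hne` leaves no third possibility. The
letter before the gap stops being movable. -/
lemma card_isFall_insertBlock (hne : IsMovable w (g + 1) → letter w g ≠ letter w (g + 1)) :
    ((Finset.range (w.length + k + 2)).filter fun i => IsFall (insertBlock N k w g) i).card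
        + (if IsFall w g then 1 else 0)
      = ((Finset.range (w.length + 2)).filter fun i => IsFall w i).card
        + (if IsTop w (g + 1) then 1 else 0) := by
  have h := card_filter_splice (fun i => IsFall w i) (fun i => IsFall (insertBlock N k w g) i)
    (k := k) hg ?_ ?_
  · have h3 : ((Finset.range k).filter fun j =>
        IsFall (insertBlock N k w g) (g + 1 + j)) = ∅ := by
      refine Finset.filter_eq_empty_iff.2 fun j hj => ?_
      have hj := Finset.mem_range.1 hj
      unfold IsFall
      rw [isMovable_insertBlock_block hg hN hN0 hj]
      rintro ⟨rfl, h⟩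
      exact h.not_gt (letter_insertBlock_lt_succ hg hN hN0 hk)
    have h4 : IsFall (insertBlock N k w g) (g + 1 + k) ↔ IsMovable w (g + 1) := by
      unfold IsFall
      rw [isMovable_insertBlock_add hg hN hN0 (by omega)]
      exact and_iff_left (letter_insertBlock_add_lt_pred hg hN hN0 hk)
    have h6 : ¬ IsFall (insertBlock N k w g) g :=
      fun h => not_isMovable_insertBlock hg hN hN0 hk h.1
    simp only [h3, h4, h6, if_false] at h
    have h5 : (if IsMovable w (g + 1) then 1 else 0)
        = (if IsTop w (g + 1) then 1 else 0) + (if IsFall w (g + 1) then 1 else 0) := by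
      by_cases hM : IsMovable w (g + 1)
      · rcases lt_or_gt_of_ne (hne hM) with hlt | hlt
        · rw [if_pos hM, if_pos ⟨hM, hlt⟩, if_neg fun h => hlt.not_gt h.2]
        · rw [if_pos hM, if_neg fun h => hlt.not_gt h.2, if_pos ⟨hM, hlt⟩]
      · rw [if_neg hM, if_neg fun h => hM h.1, if_neg fun h => hM h.1]
    rw [h5, Finset.card_empty] at h
    omega
  · intro i hi
    unfold IsFall
    rw [isMovable_insertBlock_of_lt hg hN hN0 hi, letter_insertBlock_of_le hg (by omega),
      letter_insertBlock_of_le hg (by omega)]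
  · intro i hi
    unfold IsFall
    rw [isMovable_insertBlock_add hg hN hN0 (by omega), letter_insertBlock_add hg (by omega),
      show i + k - 1 = i - 1 + k by omega, letter_insertBlock_add hg (by omega)]

/-- All letters of the block but the first are fixed. Being fixed does not depend on how a letter
compares with its predecessor, so the letter behind the gap is unaffected. -/
lemma card_isFixed_insertBlock :
    ((Finset.range (w.length + k + 2)).filter fun i => IsFixed (insertBlock N k w g) i).card
        + (if IsFixed w g then 1 else 0)
      = ((Finset.range (w.length + 2)).filter fun i => IsFixed w i).card + (k - 1) := by
  have h := card_filter_splice (fun i => IsFixed w i) (fun i => IsFixed (insertBlock N k w g) i)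
    (k := k) hg (fun i hi => isFixed_insertBlock_of_lt hg hN hN0 hi)
    (fun i hi => isFixed_insertBlock_add hg hN hN0 (by omega))
  have h3 : ((Finset.range k).filter fun j => IsFixed (insertBlock N k w g) (g + 1 + j)).card
      = k - 1 := by
    rw [← card_filter_range_ne_zero hk]
    congr 1
    exact Finset.filter_congr fun j hj =>
      isFixed_insertBlock_block hg hN hN0 (Finset.mem_range.1 hj)
  rw [h3, if_neg (not_isFixed_insertBlock hg hN hN0 hk)] at h
  simp only [isFixed_insertBlock_add hg hN hN0 (Nat.lt_add_one g)] at h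
  omega

end Insert

/-! ### The statistics of Stirling words -/

lemma sublist_letter {w : List ℕ} {i l j : ℕ} (hi : 1 ≤ i) (hil : i < l) (hlj : l < j)
    (hj : j ≤ w.length) : List.Sublist [letter w i, letter w l, letter w j] w := by
  -- The subword is built from the right, one letter at a time, inside growing suffixes; `b =
  -- w.length + 1` is the empty suffix.
  have key : ∀ (t : List ℕ) (a b : ℕ), 1 ≤ a → a < b → b ≤ w.length + 1 →
      List.Sublist t (w.drop (b - 1)) → List.Sublist (letter w a :: t) (w.drop (a - 1)) := by
    intro t a b ha hab hb ht
    obtain ⟨a, rfl⟩ : ∃ c, a = c + 1 := ⟨a - 1, by omega⟩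
    rw [Nat.add_sub_cancel, List.drop_eq_getElem_cons (by omega), letter_eq_getElem (by omega)]
    refine List.Sublist.cons_cons _ (ht.trans ?_)
    exact List.drop_sublist_drop_left _ (by omega)
  have h := key _ i l hi hil (by omega) (key _ l j (by omega) hlj (by omega)
    (key [] j (j + 1) (by omega) (by omega) (by omega) (List.nil_sublist _)))
  exact h.trans (List.drop_sublist _ _)

lemma IsStirling.le_letter {w : List ℕ} (hw : IsStirling w) {i l j : ℕ} (hi : 1 ≤ i)
    (hil : i < l) (hlj : l < j) (hj : j ≤ w.length) (h : letter w i = letter w j) :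
    letter w i ≤ letter w l := by
  refine hw _ (letter_mem hi (by omega)) _ (letter_mem (by omega) (by omega)) ?_
  have := sublist_letter hi hil hlj hj
  rwa [← h] at this

lemma isMultiple_iff_exists {w : List ℕ} {i : ℕ} (hi : 1 ≤ i) (hi' : i ≤ w.length) :
    IsMultiple w (letter w i) ↔
      ∃ j, 1 ≤ j ∧ j ≤ w.length ∧ j ≠ i ∧ letter w j = letter w i := by
  change 2 ≤ _ ↔ _
  obtain ⟨i, rfl⟩ : ∃ c, i = c + 1 := ⟨i - 1, by omega⟩
  have hi' : i < w.length := hi'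
  rw [← List.duplicate_iff_two_le_count (l := w), List.duplicate_iff_exists_distinct_get]
  constructor
  · rintro ⟨a, b, hab, ha, hb⟩
    have ha' := letter_eq_getElem a.2
    have hb' := letter_eq_getElem b.2
    have hab' : a.1 < b.1 := hab
    simp only [List.get_eq_getElem] at ha hb
    by_cases h : a.1 = i
    · exact ⟨b + 1, by omega, b.2, by omega, by rw [hb', ← hb]⟩
    · exact ⟨a + 1, by omega, a.2, by omega, by rw [ha', ← ha]⟩
  · rintro ⟨j, hj, hj', hne, h⟩
    obtain ⟨j, rfl⟩ : ∃ c, j = c + 1 := ⟨j - 1, by omega⟩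
    have h1 := letter_eq_getElem hj'
    have h2 := letter_eq_getElem hi'
    rcases lt_or_gt_of_ne (show j ≠ i by omega) with hlt | hlt
    · exact ⟨⟨j, hj'⟩, ⟨i, hi'⟩, hlt, by simp [← h, h1], by simp [h2]⟩
    · exact ⟨⟨i, hi'⟩, ⟨j, hj'⟩, hlt, by simp [h2], by simp [← h, h1]⟩

/-- An equal predecessor would make the letter both multiple and a repeat. Positivity handles `i =
1`, where the predecessor is the conventional `0`. -/
lemma IsMovable.letter_pred_ne {w : List ℕ} (hpos : ∀ x ∈ w, 0 < x) {i : ℕ}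
    (h : IsMovable w i) : letter w (i - 1) ≠ letter w i := by
  intro he
  obtain ⟨⟨h1, h2⟩, h⟩ := h
  have h0 := hpos _ (letter_mem h1 h2)
  have hi : i ≠ 1 := by
    rintro rfl
    simp only [Nat.sub_self, letter_zero] at he
    omega
  rcases h with ⟨-, h⟩ | ⟨-, h⟩
  · exact h ((isMultiple_iff_exists h1 h2).2 ⟨i - 1, by omega, by omega, by omega, he⟩)
  · exact h (i - 1) (Finset.mem_Ico.2 (by omega)) he

/-- A second copy on either side would enclose the smaller neighbour of the peak on that side. -/
lemma IsStirling.not_isMultiple_of_isPeak {w : List ℕ} (hw : IsStirling w) {i : ℕ}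
    (h1 : 1 ≤ i) (h2 : i ≤ w.length) (h : IsPeak w i) : ¬ IsMultiple w (letter w i) := by
  rw [isMultiple_iff_exists h1 h2]
  rintro ⟨j, hj, hj', hne, he⟩
  obtain ⟨hp, hn⟩ := h
  rcases lt_or_gt_of_ne hne with hlt | hlt
  · rcases eq_or_ne j (i - 1) with rfl | hj1
    · omega
    · have := hw.le_letter hj (l := i - 1) (by omega) (by omega) h2 he
      omega
  · rcases eq_or_ne j (i + 1) with rfl | hj1
    · omega
    · have := hw.le_letter h1 (l := i + 1) (by omega) (by omega) hj' he.symm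
      omega

lemma IsStirling.isFirst_of_letter_pred_lt {w : List ℕ} (hw : IsStirling w) {i : ℕ}
    (h2 : i ≤ w.length) (h : letter w (i - 1) < letter w i) : IsFirst w i := by
  intro l hl he
  rw [Finset.mem_Ico] at hl
  rcases eq_or_ne l (i - 1) with rfl | hj1
  · omega
  · have := hw.le_letter hl.1 (l := i - 1) (by omega) (by omega) h2 he
    omega

lemma filter_range_eq_filter_Icc (P Q : ℕ → Prop) [DecidablePred P] [DecidablePred Q] (m : ℕ)
    (h : ∀ i, P i ↔ (1 ≤ i ∧ i ≤ m) ∧ Q i) :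
    (Finset.range (m + 2)).filter P = (Finset.Icc 1 m).filter Q := by
  ext i
  simp only [Finset.mem_filter, Finset.mem_range, Finset.mem_Icc, h, ← and_assoc]
  refine and_congr_left fun _ => ?_
  omega

/-- The extra conditions in `IsMovable` come for free after an ascent: a peak is single, and a
plateau entered by an ascent is a first occurrence. -/
lemma IsStirling.ascpp_eq {w : List ℕ} (hw : IsStirling w) :
    ascpp w = ((Finset.range (w.length + 2)).filter fun i => IsTop w i).card := by
  rw [filter_range_eq_filter_Icc _ (fun i => IsAscentPlateau w i ∨ IsPeak w i)]
  · rfl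
  · intro i
    rw [IsTop, IsMovable, and_assoc]
    refine and_congr_right fun hi => ?_
    constructor
    · rintro ⟨⟨h1, -⟩ | ⟨h1, -⟩, h2⟩
      · exact Or.inr ⟨h2, h1⟩
      · exact Or.inl ⟨h2, h1⟩
    · rintro (h | h)
      · exact ⟨Or.inr ⟨h.2, hw.isFirst_of_letter_pred_lt hi.2 h.1⟩, h.1⟩
      · exact ⟨Or.inl ⟨h.2, hw.not_isMultiple_of_isPeak hi.1 hi.2 h⟩, h.1⟩

/-- A plateau at a first occurrence has a strictly smaller or larger predecessor, hence is an
ascent-plateau or a free descent-plateau. The unmovable plateaux are thus those at repeats. -/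
lemma IsStirling.mdup_eq {w : List ℕ} (hw : IsStirling w) (hpos : ∀ x ∈ w, 0 < x) :
    mdup w = ((Finset.range (w.length + 2)).filter fun i => IsFixed w i).card := by
  rw [filter_range_eq_filter_Icc _ (fun i => IsMultipleDescent w i ∨ IsUnmovablePlateau w i)]
  · rfl
  · intro i
    rw [IsFixed]
    refine and_congr_right fun hi => or_congr_right (and_congr_right fun he => ?_)
    constructor
    · intro h
      exact ⟨fun h' => h h'.2.2, fun h' => h (hw.isFirst_of_letter_pred_lt hi.2 h'.1)⟩
    · rintro ⟨h1, h2⟩ hf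
      have hM : IsMovable w i := ⟨hi, Or.inr ⟨he, hf⟩⟩
      rcases lt_or_gt_of_ne (hM.letter_pred_ne hpos) with h | h
      · exact h2 ⟨h, he⟩
      · exact h1 ⟨h, he, hf⟩

lemma sddes_add_fdesp (w : List ℕ) : sddes w + fdesp w
    = ((Finset.range (w.length + 2)).filter fun i => IsFall w i).card := by
  rw [filter_range_eq_filter_Icc _
    (fun i => IsSingleDoubleDescent w i ∨ IsFreeDescentPlateau w i), Finset.filter_or,
    Finset.card_union_of_disjoint]
  · rfl
  · refine Finset.disjoint_filter.2 fun i _ h h' => ?_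
    have := h.2.1
    have := h'.2.1
    omega
  · intro i
    rw [IsFall, IsMovable, and_assoc]
    refine and_congr_right fun hi => ?_
    unfold IsSingleDoubleDescent IsFreeDescentPlateau IsFirst
    tauto

end GenStirling
namespace GenStirling

/-! ### Stirling words from the insertion of blocks of maximal letters -/

lemma eq_nil_or_mem_of_append_eq {a b : ℕ} {l₁ l₂ : List ℕ} (h : [a, b, a] = l₁ ++ l₂) :
    (l₁ = [] ∨ a ∈ l₁) ∧ (l₂ = [] ∨ a ∈ l₂) := by
  constructor
  · rcases l₁ with _ | ⟨c, l₁⟩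
    · exact Or.inl rfl
    · simp only [List.cons_append, List.cons.injEq] at h
      exact Or.inr (by simp [h.1])
  · rcases List.eq_nil_or_concat l₂ with rfl | ⟨l, c, rfl⟩
    · exact Or.inl rfl
    · right
      have := congrArg List.getLast? h
      simp [← List.append_assoc] at this
      simp [this]

/-- The pattern begins and ends with `a`, so any nonempty part of it in an outer segment would put
`a` there. -/
lemma sublist_middle {a b : ℕ} {l₁ l₂ l₃ : List ℕ} (h : List.Sublist [a, b, a] (l₁ ++ (l₂ ++ l₃)))
    (h₁ : a ∉ l₁) (h₃ : a ∉ l₃) : List.Sublist [a, b, a] l₂ := by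
  obtain ⟨s, t, hst, hs, ht⟩ := List.sublist_append_iff.1 h
  have hs' : s = [] := (eq_nil_or_mem_of_append_eq hst).1.resolve_right fun h => h₁ (hs.subset h)
  subst hs'
  rw [List.nil_append] at hst
  rw [← hst] at ht
  obtain ⟨s, t, hst, hs, ht⟩ := List.sublist_append_iff.1 ht
  have ht' : t = [] := (eq_nil_or_mem_of_append_eq hst).2.resolve_right fun h => h₃ (ht.subset h)
  subst ht'
  rw [List.append_nil] at hst
  rwa [hst]

/-- Together with `takeWhile_insertBlock` this inverts insertion: deleting `N` recovers the word,
and the length of the prefix before the first `N` recovers the gap. -/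
lemma filter_insertBlock {N k : ℕ} {w : List ℕ} {g : ℕ} (hN : ∀ x ∈ w, x < N) :
    (insertBlock N k w g).filter (fun x => x ≠ N) = w := by
  unfold insertBlock
  rw [List.filter_append, List.filter_append, List.filter_eq_self.2, List.filter_eq_nil_iff.2,
    List.filter_eq_self.2, List.nil_append, List.take_append_drop]
  · intro x hx
    simpa using (hN x (List.mem_of_mem_drop hx)).ne
  · intro x hx
    simp [List.eq_of_mem_replicate hx]
  · intro x hx
    simpa using (hN x (List.mem_of_mem_take hx)).ne

lemma takeWhile_insertBlock {N k : ℕ} {w : List ℕ} {g : ℕ} (hN : ∀ x ∈ w, x < N) (hk : 0 < k)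
    (hg : g ≤ w.length) :
    ((insertBlock N k w g).takeWhile (fun x => x ≠ N)).length = g := by
  obtain ⟨k, rfl⟩ : ∃ j, k = j + 1 := ⟨k - 1, by omega⟩
  unfold insertBlock
  rw [List.takeWhile_append_of_pos, List.replicate_succ, List.cons_append,
    List.takeWhile_cons_of_neg]
  · simpa
  · simp
  · intro x hx
    simpa using (hN x (List.mem_of_mem_take hx)).ne

lemma IsStirling.sublist {w v : List ℕ} (hw : IsStirling w) (h : v.Sublist w) : IsStirling v :=
  fun a ha b hb hs => hw a (h.subset ha) b (h.subset hb) (hs.trans h)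

/-- A pattern `a b a` with `a = N` lies inside the block, so `b = N`. With `a < N`, either `b = N`
is larger or the pattern survives the deletion of `N` and lies in `w`. -/
lemma IsStirling.isStirling_insertBlock {N k : ℕ} {w : List ℕ} {g : ℕ} (hw : IsStirling w)
    (hN : ∀ x ∈ w, x < N) : IsStirling (insertBlock N k w g) := by
  have hmem : ∀ x ∈ insertBlock N k w g, x = N ∨ x ∈ w := by
    intro x hx
    rcases List.mem_append.1 ((perm_insertBlock N k w g).mem_iff.1 hx) with h | h
    · exact Or.inl (List.eq_of_mem_replicate h)
    · exact Or.inr h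
  intro a ha b hb hs
  rcases hmem a ha with rfl | ha'
  · have := sublist_middle hs (fun h => (hN _ (List.mem_of_mem_take h)).false)
      (fun h => (hN _ (List.mem_of_mem_drop h)).false)
    rw [List.eq_of_mem_replicate (this.subset (by simp : b ∈ [a, b, a]))]
  · rcases hmem b hb with rfl | hb
    · exact (hN a ha').le
    · have := hs.filter (fun x => x ≠ N)
      rw [filter_insertBlock hN] at this
      refine hw a ha' b hb ?_
      simpa [(hN a ha').ne, (hN b hb).ne] using this

/-- If `N` occurred again after its first run, the letter `c < N` ending that run would give the
forbidden pattern `N c N`. -/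
lemma IsStirling.exists_eq_insertBlock {N : ℕ} {w : List ℕ} (hw : IsStirling w)
    (hN : ∀ x ∈ w, x ≤ N) (hNw : N ∈ w) :
    (w.takeWhile (fun x => x ≠ N)).length ≤ (w.filter (fun x => x ≠ N)).length ∧
    w = insertBlock N (w.count N) (w.filter (fun x => x ≠ N))
      (w.takeWhile (fun x => x ≠ N)).length := by
  set p : ℕ → Bool := fun x => x ≠ N with hp
  set q : ℕ → Bool := fun x => x = N with hq
  set α := w.takeWhile p with hα
  set δ := w.dropWhile p with hδ
  have hw1 : w = α ++ δ := List.takeWhile_append_dropWhile.symm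
  have hδ1 : δ = δ.takeWhile q ++ δ.dropWhile q := List.takeWhile_append_dropWhile.symm
  set ρ := δ.takeWhile q with hρ
  set β := δ.dropWhile q with hβ
  have hαN : ∀ x ∈ α, p x = true := fun x hx => List.mem_takeWhile_imp hx
  have hρN : ∀ x ∈ ρ, x = N := fun x hx => by simpa [hq] using List.mem_takeWhile_imp hx
  have hδN : N ∈ δ := by
    rw [hw1, List.mem_append] at hNw
    exact hNw.resolve_left fun h => by simpa [hp] using hαN N h
  have hρ0 : N ∈ ρ := by
    have hne : δ ≠ [] := List.ne_nil_of_mem hδN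
    have h1 := List.head_dropWhile_not p hne
    rw [hρ]
    obtain ⟨c, t, hct⟩ := List.exists_cons_of_ne_nil hne
    have hc : c = N := by
      have : δ.head hne = c := by simp [hct]
      rw [this] at h1
      simpa [hp] using h1
    rw [hct, hc, List.takeWhile_cons_of_pos (by simp [hq])]
    simp
  have hβN : N ∉ β := by
    intro h
    have hne : β ≠ [] := List.ne_nil_of_mem h
    have h1 := List.head_dropWhile_not q hne
    obtain ⟨c, t, hct⟩ := List.exists_cons_of_ne_nil hne
    have hc : c ≠ N := by
      have : β.head hne = c := by simp [hct]
      rw [this] at h1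
      simpa [hq] using h1
    have hs : List.Sublist [N, c, N] w := by
      rw [hw1, hδ1]
      refine List.Sublist.trans ?_ (List.sublist_append_right _ _)
      have h2 : List.Sublist [N] ρ := List.singleton_sublist.2 hρ0
      refine List.Sublist.append (l₁ := [N]) (l₂ := ρ) (r₁ := [c, N]) h2 ?_
      rw [hct]
      rw [hct, List.mem_cons] at h
      exact List.Sublist.cons_cons _ (List.singleton_sublist.2 (h.resolve_left (Ne.symm hc)))
    have hcw : c ∈ w := hs.subset (by simp)
    have := hw N hNw c hcw hs
    have := hN c hcw
    omega
  have hρr : ρ = List.replicate ρ.length N := List.eq_replicate_of_mem hρN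
  have hwd : w = α ++ (ρ ++ β) := by rw [← hδ1, ← hw1]
  have hcount : w.count N = ρ.length := by
    rw [hwd, List.count_append, List.count_append, List.count_eq_zero_of_not_mem hβN,
      List.count_eq_zero_of_not_mem fun h => by simpa [hp] using hαN N h, hρr]
    simp
  have hfilter : w.filter p = α ++ β := by
    rw [hwd, List.filter_append, List.filter_append, List.filter_eq_self.2 hαN,
      List.filter_eq_nil_iff.2 (fun x hx => by simp [hp, hρN x hx]), List.filter_eq_self.2,
      List.nil_append]
    intro x hx
    simpa [hp] using fun h : x = N => hβN (h ▸ hx)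
  constructor
  · rw [hfilter]
    simp
  · rw [hfilter, hcount, insertBlock, List.take_left, List.drop_left, ← hρr, ← hwd]

/-! ### Recursion for the sets of Stirling permutations -/

lemma mem_stirlingPerms {n : ℕ} {m : Fin n → ℕ} {w : List ℕ} :
    w ∈ stirlingPerms m ↔ (w : Multiset ℕ) = letters m ∧ IsStirling w := by
  rw [stirlingPerms, Finset.mem_filter, Multiset.mem_toFinset, Multiset.mem_lists_iff]
  exact and_congr_left fun _ => eq_comm

lemma letters_succ {n : ℕ} (m : Fin (n + 1) → ℕ) :
    letters m = letters (fun k => m k.castSucc) + Multiset.replicate (m (Fin.last n)) (n + 1) := by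
  simp [letters, Fin.sum_univ_castSucc]

lemma mem_letters {n : ℕ} {m : Fin n → ℕ} {x : ℕ} (hx : x ∈ letters m) : 0 < x ∧ x < n + 1 := by
  rw [letters, Multiset.mem_sum] at hx
  obtain ⟨k, -, hk⟩ := hx
  have := Multiset.eq_of_mem_replicate hk
  have := k.2
  omega

lemma card_letters {n : ℕ} (m : Fin n → ℕ) : Multiset.card (letters m) = ∑ k, m k := by
  simp [letters]

lemma bounds_of_mem_stirlingPerms {n : ℕ} {m : Fin n → ℕ} {w : List ℕ}
    (hw : w ∈ stirlingPerms m) {x : ℕ} (hx : x ∈ w) : 0 < x ∧ x < n + 1 := by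
  refine mem_letters (m := m) ?_
  rw [← (mem_stirlingPerms.1 hw).1]
  exact hx

lemma length_of_mem_stirlingPerms {n : ℕ} {m : Fin n → ℕ} {w : List ℕ}
    (hw : w ∈ stirlingPerms m) : w.length = ∑ k, m k := by
  rw [← card_letters, ← (mem_stirlingPerms.1 hw).1]
  rfl

/-- Reindexing along the bijection between words and pairs of a smaller word and a gap. A nonempty
block is needed for the gap to be recoverable. -/
lemma sum_stirlingPerms_succ {A : Type*} [AddCommMonoid A] {n : ℕ} (m : Fin (n + 1) → ℕ)
    (hm : 0 < m (Fin.last n)) (f : List ℕ → A) :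
    ∑ w ∈ stirlingPerms m, f w = ∑ w ∈ stirlingPerms (fun k => m k.castSucc),
      ∑ g ∈ Finset.range (w.length + 1), f (insertBlock (n + 1) (m (Fin.last n)) w g) := by
  rw [Finset.sum_sigma']
  symm
  refine Finset.sum_bij' (fun s _ => insertBlock (n + 1) (m (Fin.last n)) s.1 s.2)
    (fun w _ => ⟨w.filter (fun x => x ≠ n + 1), (w.takeWhile (fun x => x ≠ n + 1)).length⟩)
    ?_ ?_ ?_ ?_ ?_
  · rintro ⟨w, g⟩ h
    obtain ⟨hw, -⟩ := Finset.mem_sigma.1 h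
    refine mem_stirlingPerms.2 ⟨?_, (mem_stirlingPerms.1 hw).2.isStirling_insertBlock
      fun x hx => (bounds_of_mem_stirlingPerms hw hx).2⟩
    rw [letters_succ, ← (mem_stirlingPerms.1 hw).1, add_comm (w : Multiset ℕ),
      ← Multiset.coe_replicate, Multiset.coe_add]
    exact Multiset.coe_eq_coe.2 (perm_insertBlock _ _ _ _)
  · intro w hw
    have hc : w.count (n + 1) = m (Fin.last n) := by
      rw [← Multiset.coe_count, (mem_stirlingPerms.1 hw).1, letters_succ, Multiset.count_add,
        Multiset.count_eq_zero_of_notMem fun h => (mem_letters h).2.false]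
      simp
    have hmem : n + 1 ∈ w := List.count_pos_iff.1 (by omega)
    obtain ⟨h1, h2⟩ := (mem_stirlingPerms.1 hw).2.exists_eq_insertBlock
      (fun x hx => Nat.lt_succ_iff.1 (bounds_of_mem_stirlingPerms hw hx).2) hmem
    refine Finset.mem_sigma.2 ⟨mem_stirlingPerms.2 ⟨?_,
      (mem_stirlingPerms.1 hw).2.sublist List.filter_sublist⟩, Finset.mem_range.2 (by
        exact Nat.lt_succ_iff.2 h1)⟩
    rw [← Multiset.filter_coe, (mem_stirlingPerms.1 hw).1, letters_succ, Multiset.filter_add,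
      Multiset.filter_eq_self.2 fun x hx => by simpa using (mem_letters hx).2.ne,
      Multiset.filter_eq_nil.2 fun x hx => by simp [Multiset.eq_of_mem_replicate hx]]
    simp
  · rintro ⟨w, g⟩ h
    obtain ⟨hw, hg⟩ := Finset.mem_sigma.1 h
    have hg := Finset.mem_range.1 hg
    have hN : ∀ x ∈ w, x < n + 1 := fun x hx => (bounds_of_mem_stirlingPerms hw hx).2
    simp only [filter_insertBlock hN, takeWhile_insertBlock hN hm (Nat.lt_succ_iff.1 hg)]
  · intro w hw
    have hc : w.count (n + 1) = m (Fin.last n) := by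
      rw [← Multiset.coe_count, (mem_stirlingPerms.1 hw).1, letters_succ, Multiset.count_add,
        Multiset.count_eq_zero_of_notMem fun h => (mem_letters h).2.false]
      simp
    have hmem : n + 1 ∈ w := List.count_pos_iff.1 (by omega)
    have h2 := ((mem_stirlingPerms.1 hw).2.exists_eq_insertBlock
      (fun x hx => Nat.lt_succ_iff.1 (bounds_of_mem_stirlingPerms hw hx).2) hmem).2
    rw [hc] at h2
    exact h2.symm
  · intro _ _
    rfl

end GenStirling
namespace GenStirling

open MvPolynomial

/-! ### Generating functions -/

lemma sum_ite_const {A : Type*} [Semiring A] (s : Finset ℕ) (P : ℕ → Prop) [DecidablePred P]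
    (c : A) : ∑ i ∈ s, (if P i then c else 0) = ((s.filter P).card : A) * c := by
  rw [← Finset.sum_filter, Finset.sum_const, nsmul_eq_mul]

/-- Both sides satisfy the Leibniz rule along `f`, so agreement on the variables suffices. -/
lemma derivation_algHom {σ τ : Type*} (f : MvPolynomial σ ℤ →ₐ[ℤ] MvPolynomial τ ℤ)
    (D : Derivation ℤ (MvPolynomial σ ℤ) (MvPolynomial σ ℤ))
    (D' : Derivation ℤ (MvPolynomial τ ℤ) (MvPolynomial τ ℤ))
    (h : ∀ i, D' (f (X i)) = f (D (X i))) (p : MvPolynomial σ ℤ) : D' (f p) = f (D p) := by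
  induction p using MvPolynomial.induction_on with
  | C a =>
    rw [← MvPolynomial.algebraMap_eq, AlgHom.commutes, Derivation.map_algebraMap,
      Derivation.map_algebraMap, map_zero]
  | add p q hp hq => rw [map_add, map_add, map_add, map_add, hp, hq]
  | mul_X p i hp =>
    rw [map_mul, Derivation.leibniz, Derivation.leibniz, map_add, h i, hp]
    simp only [smul_eq_mul, map_mul]

/-- The derivation sending each of `x, y, z` to `xy`. -/
noncomputable def derivXYZ :
    Derivation ℤ (MvPolynomial (Fin 3) ℤ) (MvPolynomial (Fin 3) ℤ) :=
  mkDerivation ℤ fun _ => X 0 * X 1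

/-- The derivation `u ↦ uv`, `v ↦ 2u`, `z ↦ u` on polynomials in `u = X 0`, `v = X 1`, `z = X 2`. -/
noncomputable def derivUVZ :
    Derivation ℤ (MvPolynomial (Fin 3) ℤ) (MvPolynomial (Fin 3) ℤ) :=
  mkDerivation ℤ ![X 0 * X 1, X 0 + X 0, X 0]

/-- The derivation `u ↦ u(a+b)`, `z ↦ u`, `a ↦ u`, `b ↦ u` on polynomials in `u = X 0`, `z = X 1`,
`a = X 2`, `b = X 3`. -/
noncomputable def derivUZAB :
    Derivation ℤ (MvPolynomial (Fin 4) ℤ) (MvPolynomial (Fin 4) ℤ) :=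
  mkDerivation ℤ ![X 0 * (X 2 + X 3), X 0, X 0, X 0]

/-- The substitution `u = xy`, `v = x + y`, `z = z`. -/
noncomputable def substXYZ : MvPolynomial (Fin 3) ℤ →ₐ[ℤ] MvPolynomial (Fin 3) ℤ :=
  aeval ![X 0 * X 1, X 0 + X 1, X 2]

/-- The substitution `u = u`, `v = a + b`, `z = z`. -/
noncomputable def substUZAB : MvPolynomial (Fin 3) ℤ →ₐ[ℤ] MvPolynomial (Fin 4) ℤ :=
  aeval ![X 0, X 2 + X 3, X 1]

/-- The substitution `u = xy`, `z = z`, `a = x + y`, `b = 0`. -/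
noncomputable def collapse : MvPolynomial (Fin 4) ℤ →ₐ[ℤ] MvPolynomial (Fin 3) ℤ :=
  aeval ![X 0 * X 1, X 2, X 0 + X 1, 0]

lemma derivXYZ_substXYZ (p : MvPolynomial (Fin 3) ℤ) :
    derivXYZ (substXYZ p) = substXYZ (derivUVZ p) := by
  refine derivation_algHom _ _ _ (fun i => ?_) p
  fin_cases i
  · simp [substXYZ, derivXYZ, derivUVZ, mkDerivation_X, Derivation.leibniz]
    ring
  · simp [substXYZ, derivXYZ, derivUVZ, mkDerivation_X]
  · simp [substXYZ, derivXYZ, derivUVZ, mkDerivation_X]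

lemma derivUZAB_substUZAB (p : MvPolynomial (Fin 3) ℤ) :
    derivUZAB (substUZAB p) = substUZAB (derivUVZ p) := by
  refine derivation_algHom _ _ _ (fun i => ?_) p
  fin_cases i
  · simp [substUZAB, derivUZAB, derivUVZ, mkDerivation_X]
  · simp [substUZAB, derivUZAB, derivUVZ, mkDerivation_X]
  · simp [substUZAB, derivUZAB, derivUVZ, mkDerivation_X]

lemma collapse_substUZAB (p : MvPolynomial (Fin 3) ℤ) :
    collapse (substUZAB p) = substXYZ p := by
  have : collapse.comp substUZAB = substXYZ := by
    refine MvPolynomial.algHom_ext fun i => ?_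
    fin_cases i <;> simp [collapse, substUZAB, substXYZ]
  rw [← this]
  rfl

/-! ### Insertion as a derivation on monomial weights. -/

lemma derivXYZ_monomial (a d p : ℕ) :
    derivXYZ (X 0 ^ a * X 1 ^ d * X 2 ^ p) = X 0 * X 1 *
      (C (a : ℤ) * (X 0 ^ (a - 1) * X 1 ^ d * X 2 ^ p) + C (d : ℤ) * (X 0 ^ a * X 1 ^ (d - 1) * X 2 ^ p)
        + C (p : ℤ) * (X 0 ^ a * X 1 ^ d * X 2 ^ (p - 1))) := by
  simp only [Derivation.leibniz, Derivation.leibniz_pow, derivXYZ, mkDerivation_X, smul_eq_mul,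
    nsmul_eq_mul, map_natCast]
  ring

/-- The five terms match the five kinds of gap in `gap_cases`: two for each factor `u`, one for each
factor `z`, `a` and `b`. -/
lemma derivUZAB_monomial (p q r s : ℕ) :
    derivUZAB (X 0 ^ p * X 1 ^ q * X 2 ^ r * X 3 ^ s) =
      C (p : ℤ) * (X 0 ^ p * X 1 ^ q * X 2 ^ (r + 1) * X 3 ^ s)
        + C (p : ℤ) * (X 0 ^ p * X 1 ^ q * X 2 ^ r * X 3 ^ (s + 1))
        + C (q : ℤ) * (X 0 ^ (p + 1) * X 1 ^ (q - 1) * X 2 ^ r * X 3 ^ s)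
        + C (r : ℤ) * (X 0 ^ (p + 1) * X 1 ^ q * X 2 ^ (r - 1) * X 3 ^ s)
        + C (s : ℤ) * (X 0 ^ (p + 1) * X 1 ^ q * X 2 ^ r * X 3 ^ (s - 1)) := by
  simp only [Derivation.leibniz, Derivation.leibniz_pow, derivUZAB, mkDerivation_X, smul_eq_mul,
    nsmul_eq_mul, Matrix.cons_val, map_natCast]
  -- The factors `X 0 ^ (p - 1)` and `X 0` merge into `X 0 ^ p` only for `p > 0`; for `p = 0` the
  -- coefficient vanishes.
  rcases p with _ | p
  · simp
    ring
  · simp only [Nat.add_sub_cancel]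
    push_cast
    ring

/-- The monomial `x^{asc w} y^{des w} z^{plat w}`. -/
noncomputable def gapWeight (w : List ℕ) : MvPolynomial (Fin 3) ℤ :=
  X 0 ^ asc w * X 1 ^ des w * X 2 ^ plat w

lemma sum_gapWeight_insertBlock {N k : ℕ} {w : List ℕ} (hN : ∀ x ∈ w, x < N) (hN0 : 0 < N)
    (hk : 0 < k) : ∑ g ∈ Finset.range (w.length + 1), gapWeight (insertBlock N k w g)
      = X 2 ^ (k - 1) * derivXYZ (gapWeight w) := by
  unfold gapWeight
  rw [derivXYZ_monomial]
  simp only [map_natCast]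
  conv_rhs => rw [asc, des, plat, ← sum_ite_const, ← sum_ite_const, ← sum_ite_const,
    ← asc, ← des, ← plat]
  rw [← Finset.sum_add_distrib, ← Finset.sum_add_distrib, Finset.mul_sum, Finset.mul_sum]
  refine Finset.sum_congr rfl fun g hg => ?_
  have hg' := Nat.lt_succ_iff.1 (Finset.mem_range.1 hg)
  have ha := asc_insertBlock hk hg' hN hN0
  have hd := des_insertBlock hk hg' hN hN0
  have hp := plat_insertBlock hk hg' hN hN0
  rcases lt_trichotomy (letter w g) (letter w (g + 1)) with h | h | h
  -- The gap itself witnesses that the exponent being lowered is positive, so the subtraction is not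
  -- truncated.
  · have hpos : 0 < asc w := Finset.card_pos.2 ⟨g, Finset.mem_filter.2 ⟨hg, h⟩⟩
    rw [if_pos h] at ha ⊢
    rw [if_neg h.not_gt] at hd ⊢
    rw [if_neg h.ne] at hp ⊢
    obtain ⟨a, haa⟩ : ∃ a, asc w = a + 1 := ⟨asc w - 1, by omega⟩
    rw [show asc (insertBlock N k w g) = a + 1 by omega,
      show des (insertBlock N k w g) = des w + 1 by omega,
      show plat (insertBlock N k w g) = plat w + (k - 1) by omega, haa, Nat.add_sub_cancel]
    ring
  · have hpos : 0 < plat w := Finset.card_pos.2 ⟨g, Finset.mem_filter.2 ⟨hg, h⟩⟩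
    rw [if_neg h.not_lt] at ha ⊢
    rw [if_neg h.not_gt] at hd ⊢
    rw [if_pos h] at hp ⊢
    obtain ⟨a, haa⟩ : ∃ a, plat w = a + 1 := ⟨plat w - 1, by omega⟩
    rw [show asc (insertBlock N k w g) = asc w + 1 by omega,
      show des (insertBlock N k w g) = des w + 1 by omega,
      show plat (insertBlock N k w g) = a + (k - 1) by omega, haa, Nat.add_sub_cancel]
    ring
  · have hpos : 0 < des w := Finset.card_pos.2 ⟨g, Finset.mem_filter.2 ⟨hg, h⟩⟩
    rw [if_neg h.not_gt] at ha ⊢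
    rw [if_pos h] at hd ⊢
    rw [if_neg h.ne'] at hp ⊢
    obtain ⟨a, haa⟩ : ∃ a, des w = a + 1 := ⟨des w - 1, by omega⟩
    rw [show asc (insertBlock N k w g) = asc w + 1 by omega,
      show des (insertBlock N k w g) = a + 1 by omega,
      show plat (insertBlock N k w g) = plat w + (k - 1) by omega, haa, Nat.add_sub_cancel]
    ring

/-- The gap after the `g`-th letter is none of the gaps counted by `ascpp` (twice), `mdup`,
`sddes` and `fdesp`. -/
def IsNeutralGap (w : List ℕ) (g : ℕ) : Prop :=
  ¬ IsTop w g ∧ ¬ IsTop w (g + 1) ∧ ¬ IsFixed w g ∧ ¬ IsFall w g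

instance (w : List ℕ) : DecidablePred (IsNeutralGap w) := fun i => by
  unfold IsNeutralGap
  infer_instance

/-- A top and a fall differ in the comparison with the preceding letter, and both are movable, hence
not fixed. A top just after the gap requires an ascent across it, which each of the other three
kinds forbids. -/
lemma gap_cases (w : List ℕ) (g : ℕ) :
    (IsTop w g ∧ ¬ IsTop w (g + 1) ∧ ¬ IsFixed w g ∧ ¬ IsFall w g ∧ ¬ IsNeutralGap w g) ∨
    (¬ IsTop w g ∧ IsTop w (g + 1) ∧ ¬ IsFixed w g ∧ ¬ IsFall w g ∧ ¬ IsNeutralGap w g) ∨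
    (¬ IsTop w g ∧ ¬ IsTop w (g + 1) ∧ IsFixed w g ∧ ¬ IsFall w g ∧ ¬ IsNeutralGap w g) ∨
    (¬ IsTop w g ∧ ¬ IsTop w (g + 1) ∧ ¬ IsFixed w g ∧ IsFall w g ∧ ¬ IsNeutralGap w g) ∨
    (¬ IsTop w g ∧ ¬ IsTop w (g + 1) ∧ ¬ IsFixed w g ∧ ¬ IsFall w g ∧ IsNeutralGap w g) := by
  have h1 : IsTop w g → ¬ IsFixed w g := fun h => not_movable_and_fixed h.1
  have h2 : IsFall w g → ¬ IsFixed w g := fun h => not_movable_and_fixed h.1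
  have h3 : IsTop w g → ¬ IsFall w g := fun h h' => h.2.not_gt h'.2
  have h4 : IsTop w (g + 1) → ¬ letter w (g + 1) ≤ letter w g := fun h => h.2.not_ge
  have h5 : IsTop w g → ¬ IsTop w (g + 1) := fun h h' => h4 h' h.1.letter_succ_le
  have h6 : IsFixed w g → ¬ IsTop w (g + 1) := fun h h' => h4 h' h.letter_succ_le
  have h7 : IsFall w g → ¬ IsTop w (g + 1) := fun h h' => h4 h' h.1.letter_succ_le
  unfold IsNeutralGap
  by_cases a : IsTop w g
  · exact Or.inl ⟨a, h5 a, h1 a, h3 a, fun h => h.1 a⟩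
  by_cases c : IsFixed w g
  · exact Or.inr (Or.inr (Or.inl ⟨a, h6 c, c, fun h => h2 h c, fun h => h.2.2.1 c⟩))
  by_cases d : IsFall w g
  · exact Or.inr (Or.inr (Or.inr (Or.inl ⟨a, h7 d, c, d, fun h => h.2.2.2 d⟩)))
  by_cases b : IsTop w (g + 1)
  · exact Or.inr (Or.inl ⟨a, b, c, d, fun h => h.2.1 b⟩)
  · exact Or.inr (Or.inr (Or.inr (Or.inr ⟨a, b, c, d, a, b, c, d⟩)))

lemma gap_indicators (w : List ℕ) (g : ℕ) :
    (if IsTop w g then 1 else 0) + (if IsTop w (g + 1) then 1 else 0)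
      + (if IsFixed w g then 1 else 0) + (if IsFall w g then 1 else 0)
      + (if IsNeutralGap w g then 1 else 0) = 1 := by
  rcases gap_cases w g with ⟨a, b, c, d, e⟩ | ⟨a, b, c, d, e⟩ | ⟨a, b, c, d, e⟩ |
    ⟨a, b, c, d, e⟩ | ⟨a, b, c, d, e⟩
  · rw [if_pos a, if_neg b, if_neg c, if_neg d, if_neg e]
  · rw [if_neg a, if_pos b, if_neg c, if_neg d, if_neg e]
  · rw [if_neg a, if_neg b, if_pos c, if_neg d, if_neg e]
  · rw [if_neg a, if_neg b, if_neg c, if_pos d, if_neg e]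
  · rw [if_neg a, if_neg b, if_neg c, if_neg d, if_pos e]

lemma card_filter_range_succ (P : ℕ → Prop) [DecidablePred P] (m : ℕ)
    (h : P (m + 1) → False) :
    ((Finset.range (m + 1)).filter P).card = ((Finset.range (m + 2)).filter P).card := by
  rw [Finset.range_add_one (n := m + 1), Finset.filter_insert, if_neg h]

lemma card_filter_range_shift (P : ℕ → Prop) [DecidablePred P] (m : ℕ) (h : P 0 → False) :
    ((Finset.range (m + 1)).filter fun i => P (i + 1)).card
      = ((Finset.range (m + 2)).filter P).card := by
  rw [Finset.card_filter, Finset.card_filter, Finset.sum_range_succ' _ (m + 1), if_neg h, add_zero]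

/-- The indices `0` and `w.length + 1` are neither movable nor fixed, so counting over gaps agrees
with counting over letters. -/
lemma IsStirling.card_gaps {w : List ℕ} (hw : IsStirling w) (hpos : ∀ x ∈ w, 0 < x) :
    ((Finset.range (w.length + 1)).filter fun g => IsTop w g).card = ascpp w ∧
    ((Finset.range (w.length + 1)).filter fun g => IsTop w (g + 1)).card = ascpp w ∧
    ((Finset.range (w.length + 1)).filter fun g => IsFixed w g).card = mdup w ∧
    ((Finset.range (w.length + 1)).filter fun g => IsFall w g).card = sddes w + fdesp w := by
  rw [hw.ascpp_eq, hw.mdup_eq hpos, sddes_add_fdesp]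
  refine ⟨card_filter_range_succ _ _ fun h => ?_, card_filter_range_shift (fun i => IsTop w i) _ fun h => ?_,
    card_filter_range_succ _ _ fun h => ?_, card_filter_range_succ _ _ fun h => ?_⟩
  · have := h.1.1
    omega
  · have := h.1.1
    omega
  · have := h.1
    omega
  · have := h.1.1
    omega

/-- The gaps are partitioned by kind, each top owning two. Hence the subtraction in `moveWeight` is
exact and its value is the number of neutral gaps. -/
lemma IsStirling.card_neutralGap {w : List ℕ} (hw : IsStirling w) (hpos : ∀ x ∈ w, 0 < x) :
    2 * ascpp w + mdup w + (sddes w + fdesp w)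
      + ((Finset.range (w.length + 1)).filter fun g => IsNeutralGap w g).card
      = w.length + 1 := by
  obtain ⟨h1, h2, h3, h4⟩ := hw.card_gaps hpos
  have := Finset.sum_congr rfl fun g (_ : g ∈ Finset.range (w.length + 1)) => gap_indicators w g
  simp only [Finset.sum_add_distrib, ← Finset.card_filter, h1, h2, h3, h4, Finset.sum_const,
    Finset.card_range, smul_eq_mul] at this
  omega

/-- The monomial `u^{ascpp w} z^{mdup w} a^r b^{sddes w + fdesp w}`, with `r` such that
`2 ascpp w + mdup w + r + sddes w + fdesp w` is the number of gaps of `w`. -/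
noncomputable def moveWeight (w : List ℕ) : MvPolynomial (Fin 4) ℤ :=
  X 0 ^ ascpp w * X 1 ^ mdup w * X 2 ^ (w.length + 1 - mdup w - 2 * ascpp w - (sddes w + fdesp w))
    * X 3 ^ (sddes w + fdesp w)

/-- Apart from the factor `z^(k-1)`, a gap just after a top turns `u` into `ua`, and one just before
a top turns `u` into `ub`, since the old top becomes a fall. At a fixed, neutral or fall gap, the
factor `z`, `a` or `b` is replaced by `u`. -/
lemma IsStirling.sum_moveWeight_insertBlock {N k : ℕ} {w : List ℕ} (hw : IsStirling w)
    (hpos : ∀ x ∈ w, 0 < x) (hN : ∀ x ∈ w, x < N) (hN0 : 0 < N) (hk : 0 < k) :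
    ∑ g ∈ Finset.range (w.length + 1), moveWeight (insertBlock N k w g)
      = X 1 ^ (k - 1) * derivUZAB (moveWeight w) := by
  obtain ⟨h1, h2, h3, h4⟩ := hw.card_gaps hpos
  have h5 := hw.card_neutralGap hpos
  have hr : w.length + 1 - mdup w - 2 * ascpp w - (sddes w + fdesp w)
      = ((Finset.range (w.length + 1)).filter fun g => IsNeutralGap w g).card := by omega
  have hstep : ∀ g ∈ Finset.range (w.length + 1),
      (ascpp (insertBlock N k w g) + (if IsTop w g then 1 else 0)
        + (if IsTop w (g + 1) then 1 else 0) = ascpp w + 1 ∧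
      mdup (insertBlock N k w g) + (if IsFixed w g then 1 else 0) = mdup w + (k - 1) ∧
      sddes (insertBlock N k w g) + fdesp (insertBlock N k w g) + (if IsFall w g then 1 else 0)
        = sddes w + fdesp w + (if IsTop w (g + 1) then 1 else 0)) := by
    intro g hg
    have hg' := Nat.lt_succ_iff.1 (Finset.mem_range.1 hg)
    have hw' : IsStirling (insertBlock N k w g) := hw.isStirling_insertBlock hN
    have hpos' : ∀ x ∈ insertBlock N k w g, 0 < x := by
      intro x hx
      rcases List.mem_append.1 ((perm_insertBlock N k w g).mem_iff.1 hx) with h | h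
      · rwa [List.eq_of_mem_replicate h]
      · exact hpos x h
    rw [hw'.ascpp_eq, hw'.mdup_eq hpos', sddes_add_fdesp, hw.ascpp_eq, hw.mdup_eq hpos,
      sddes_add_fdesp, length_insertBlock]
    exact ⟨card_isTop_insertBlock hg' hN hN0 hk, card_isFixed_insertBlock hg' hN hN0 hk,
      card_isFall_insertBlock hg' hN hN0 hk fun h => h.letter_pred_ne hpos⟩
  unfold moveWeight
  rw [derivUZAB_monomial, hr]
  simp only [map_natCast, length_insertBlock]
  set p := ascpp w with hp
  set q := mdup w with hq
  set s := sddes w + fdesp w with hs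
  set r := ((Finset.range (w.length + 1)).filter fun g => IsNeutralGap w g).card with hrr
  have hsum : ∀ c₁ c₂ c₃ c₄ c₅ : MvPolynomial (Fin 4) ℤ,
      p * c₁ + p * c₂ + q * c₃ + r * c₄ + s * c₅ = ∑ g ∈ Finset.range (w.length + 1),
        ((if IsTop w g then c₁ else 0) + (if IsTop w (g + 1) then c₂ else 0)
          + (if IsFixed w g then c₃ else 0) + (if IsNeutralGap w g then c₄ else 0)
          + (if IsFall w g then c₅ else 0)) := by
    intro c₁ c₂ c₃ c₄ c₅
    simp only [Finset.sum_add_distrib, sum_ite_const, h1, h2, h3, h4, hrr]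
  rw [hsum, Finset.mul_sum]
  refine Finset.sum_congr rfl fun g hg => ?_
  obtain ⟨e1, e2, e3⟩ := hstep g hg
  have hlen : w.length + k + 1 = 2 * p + q + s + r + k := by omega
  rw [hlen]
  rcases gap_cases w g with ⟨a, b, c, d, e⟩ | ⟨a, b, c, d, e⟩ | ⟨a, b, c, d, e⟩ |
    ⟨a, b, c, d, e⟩ | ⟨a, b, c, d, e⟩
  · rw [if_pos a, if_neg b] at e1
    rw [if_neg c] at e2
    rw [if_neg d, if_neg b] at e3
    rw [if_pos a, if_neg b, if_neg c, if_neg d, if_neg e,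
      show 2 * p + q + s + r + k - mdup (insertBlock N k w g) - 2 * ascpp (insertBlock N k w g)
        - (sddes (insertBlock N k w g) + fdesp (insertBlock N k w g)) = r + 1 by omega,
      show ascpp (insertBlock N k w g) = p by omega,
      show mdup (insertBlock N k w g) = q + (k - 1) by omega,
      show sddes (insertBlock N k w g) + fdesp (insertBlock N k w g) = s by omega]
    ring
  · rw [if_neg a, if_pos b] at e1
    rw [if_neg c] at e2
    rw [if_neg d, if_pos b] at e3
    rw [if_neg a, if_pos b, if_neg c, if_neg d, if_neg e,
      show 2 * p + q + s + r + k - mdup (insertBlock N k w g) - 2 * ascpp (insertBlock N k w g)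
        - (sddes (insertBlock N k w g) + fdesp (insertBlock N k w g)) = r by omega,
      show ascpp (insertBlock N k w g) = p by omega,
      show mdup (insertBlock N k w g) = q + (k - 1) by omega,
      show sddes (insertBlock N k w g) + fdesp (insertBlock N k w g) = s + 1 by omega]
    ring
  · rw [if_neg a, if_neg b] at e1
    rw [if_pos c] at e2
    rw [if_neg d, if_neg b] at e3
    have hq0 : 0 < q := by
      rw [← h3]
      exact Finset.card_pos.2 ⟨g, Finset.mem_filter.2 ⟨hg, c⟩⟩
    rw [if_neg a, if_neg b, if_pos c, if_neg d, if_neg e,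
      show 2 * p + q + s + r + k - mdup (insertBlock N k w g) - 2 * ascpp (insertBlock N k w g)
        - (sddes (insertBlock N k w g) + fdesp (insertBlock N k w g)) = r by omega,
      show ascpp (insertBlock N k w g) = p + 1 by omega,
      show mdup (insertBlock N k w g) = (q - 1) + (k - 1) by omega,
      show sddes (insertBlock N k w g) + fdesp (insertBlock N k w g) = s by omega]
    ring
  · rw [if_neg a, if_neg b] at e1
    rw [if_neg c] at e2
    rw [if_pos d, if_neg b] at e3
    have hs0 : 0 < s := by
      rw [← h4]
      exact Finset.card_pos.2 ⟨g, Finset.mem_filter.2 ⟨hg, d⟩⟩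
    rw [if_neg a, if_neg b, if_neg c, if_pos d, if_neg e,
      show 2 * p + q + s + r + k - mdup (insertBlock N k w g) - 2 * ascpp (insertBlock N k w g)
        - (sddes (insertBlock N k w g) + fdesp (insertBlock N k w g)) = r by omega,
      show ascpp (insertBlock N k w g) = p + 1 by omega,
      show mdup (insertBlock N k w g) = q + (k - 1) by omega,
      show sddes (insertBlock N k w g) + fdesp (insertBlock N k w g) = s - 1 by omega]
    ring
  · rw [if_neg a, if_neg b] at e1
    rw [if_neg c] at e2
    rw [if_neg d, if_neg b] at e3
    have hr0 : 0 < r := Finset.card_pos.2 ⟨g, Finset.mem_filter.2 ⟨hg, e⟩⟩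
    rw [if_neg a, if_neg b, if_neg c, if_neg d, if_pos e,
      show 2 * p + q + s + r + k - mdup (insertBlock N k w g) - 2 * ascpp (insertBlock N k w g)
        - (sddes (insertBlock N k w g) + fdesp (insertBlock N k w g)) = r - 1 by omega,
      show ascpp (insertBlock N k w g) = p + 1 by omega,
      show mdup (insertBlock N k w g) = q + (k - 1) by omega,
      show sddes (insertBlock N k w g) + fdesp (insertBlock N k w g) = s by omega]
    ring

end GenStirling
-- The common polynomial and the gamma expansion.
namespace GenStirling

open MvPolynomial

lemma sum_gapWeight_succ {n : ℕ} (m : Fin (n + 1) → ℕ) (hm : ∀ k, 0 < m k) :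
    ∑ w ∈ stirlingPerms m, gapWeight w = X 2 ^ (m (Fin.last n) - 1) *
      derivXYZ (∑ w ∈ stirlingPerms (fun k => m k.castSucc), gapWeight w) := by
  rw [sum_stirlingPerms_succ m (hm _), map_sum, Finset.mul_sum]
  exact Finset.sum_congr rfl fun w hw => sum_gapWeight_insertBlock
    (fun x hx => (bounds_of_mem_stirlingPerms hw hx).2) n.succ_pos (hm _)

lemma sum_moveWeight_succ {n : ℕ} (m : Fin (n + 1) → ℕ) (hm : ∀ k, 0 < m k) :
    ∑ w ∈ stirlingPerms m, moveWeight w = X 1 ^ (m (Fin.last n) - 1) *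
      derivUZAB (∑ w ∈ stirlingPerms (fun k => m k.castSucc), moveWeight w) := by
  rw [sum_stirlingPerms_succ m (hm _), map_sum, Finset.mul_sum]
  exact Finset.sum_congr rfl fun w hw =>
    (mem_stirlingPerms.1 hw).2.sum_moveWeight_insertBlock
      (fun x hx => (bounds_of_mem_stirlingPerms hw hx).1)
      (fun x hx => (bounds_of_mem_stirlingPerms hw hx).2) n.succ_pos (hm _)

lemma stirlingPerms_zero (m : Fin 0 → ℕ) : stirlingPerms m = {[]} := by
  ext w
  rw [mem_stirlingPerms, Finset.mem_singleton]
  constructor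
  · rintro ⟨h, -⟩
    simpa [letters] using h
  · rintro rfl
    exact ⟨by simp [letters], fun a ha => by simp at ha⟩

/-- The induction starts at one letter: the empty word has weights `z` and `a`, which do not come
from one polynomial, but the two derivations send them to `xy` and `u`, both images of `u`. -/
lemma exists_common_polynomial {n : ℕ} (m : Fin (n + 1) → ℕ) (hm : ∀ k, 0 < m k) :
    ∃ G : MvPolynomial (Fin 3) ℤ, ∑ w ∈ stirlingPerms m, gapWeight w = substXYZ G ∧
      ∑ w ∈ stirlingPerms m, moveWeight w = substUZAB G := by
  induction n with
  | zero =>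
    refine ⟨X 2 ^ (m (Fin.last 0) - 1) * X 0, ?_, ?_⟩
    · have : gapWeight [] = X 2 := by
        have h1 : asc [] = 0 := rfl
        have h2 : des [] = 0 := rfl
        have h3 : plat [] = 1 := rfl
        simp [gapWeight, h1, h2, h3]
      rw [sum_gapWeight_succ m hm, stirlingPerms_zero, Finset.sum_singleton, this]
      simp [derivXYZ, mkDerivation_X, substXYZ]
    · have : moveWeight [] = X 2 := by
        have h1 : ascpp [] = 0 := rfl
        have h2 : mdup [] = 0 := rfl
        have h3 : sddes [] = 0 := rfl
        have h4 : fdesp [] = 0 := rfl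
        simp [moveWeight, h1, h2, h3, h4]
      rw [sum_moveWeight_succ m hm, stirlingPerms_zero, Finset.sum_singleton, this]
      simp [derivUZAB, mkDerivation_X, substUZAB]
  | succ n ih =>
    obtain ⟨G, h1, h2⟩ := ih (fun k => m k.castSucc) fun k => hm _
    refine ⟨X 2 ^ (m (Fin.last (n + 1)) - 1) * derivUVZ G, ?_, ?_⟩
    · rw [sum_gapWeight_succ m hm, h1, derivXYZ_substXYZ, map_mul]
      simp [substXYZ]
    · rw [sum_moveWeight_succ m hm, h2, derivUZAB_substUZAB, map_mul]
      simp [substUZAB]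

lemma stirlingPoly_eq_collapse {n : ℕ} (m : Fin n → ℕ) (hn : 0 < n) (hm : ∀ k, 0 < m k) :
    stirlingPoly m = ∑ w ∈ stirlingPerms m, collapse (moveWeight w) := by
  obtain ⟨n, rfl⟩ : ∃ c, n = c + 1 := ⟨n - 1, by omega⟩
  obtain ⟨G, h1, h2⟩ := exists_common_polynomial m hm
  rw [← map_sum, h2, collapse_substUZAB, ← h1]
  rfl

lemma collapse_moveWeight (w : List ℕ) : collapse (moveWeight w) =
    if sddes w = 0 ∧ fdesp w = 0 then
      X 2 ^ mdup w * ((X 0 * X 1) ^ ascpp w * (X 0 + X 1) ^ (w.length + 1 - mdup w - 2 * ascpp w))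
    else 0 := by
  split_ifs with h
  · simp [moveWeight, collapse, h.1, h.2]
    ring
  · have hne : sddes w = 0 → fdesp w ≠ 0 := fun h1 h2 => h ⟨h1, h2⟩
    simp only [moveWeight, collapse, map_mul, map_pow, aeval_X, Matrix.cons_val]
    rw [zero_pow (by omega), mul_zero]

/-- The first copy of the largest letter is a top. This is why the expansion starts at `j = 1`. -/
lemma ascpp_pos_of_mem_stirlingPerms {n : ℕ} {m : Fin (n + 1) → ℕ} (hm : 0 < m (Fin.last n))
    {w : List ℕ} (hw : w ∈ stirlingPerms m) : 0 < ascpp w := by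
  have hS := (mem_stirlingPerms.1 hw).2
  have hmem : n + 1 ∈ w := by
    rw [← Multiset.mem_coe, (mem_stirlingPerms.1 hw).1, letters_succ, Multiset.mem_add]
    exact Or.inr (Multiset.mem_replicate.2 ⟨hm.ne', rfl⟩)
  have hle : ∀ x ∈ w, x ≤ n + 1 := fun x hx =>
    Nat.lt_succ_iff.1 (bounds_of_mem_stirlingPerms hw hx).2
  obtain ⟨hg, he⟩ := hS.exists_eq_insertBlock hle hmem
  have hN : ∀ x ∈ w.filter (fun x => x ≠ n + 1), x < n + 1 := by
    intro x hx
    rw [List.mem_filter] at hx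
    have := hle x hx.1
    have : x ≠ n + 1 := by simpa using hx.2
    omega
  have hk := List.count_pos_iff.2 hmem
  have htop : IsTop w ((w.takeWhile (fun x => x ≠ n + 1)).length + 1) := by
    have h1 := (isMovable_insertBlock_block hg hN n.succ_pos hk).2 rfl
    have h2 := letter_insertBlock_lt_succ hg hN n.succ_pos hk
    rw [← he] at h1 h2
    exact ⟨h1, h2⟩
  rw [hS.ascpp_eq]
  have := htop.1.1
  exact Finset.card_pos.2 ⟨_, Finset.mem_filter.2 ⟨Finset.mem_range.2 (by omega), htop⟩⟩

/-- The words are grouped by `mdup` and `ascpp`. No word falls outside the summation ranges, because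
`2 * ascpp w + mdup w ≤ M + 1` and `ascpp w ≥ 1` force `mdup w < M`. -/
lemma stirlingPoly_eq_sum_gammaCoeff {n : ℕ} (hn : 0 < n) (m : Fin n → ℕ) (hm : ∀ k, 0 < m k)
    {M : ℕ} (hM : ∑ k, m k = M) :
    stirlingPoly m = ∑ i ∈ Finset.range M, X 2 ^ i * ∑ j ∈ Finset.Icc 1 ((M + 1 - i) / 2),
      (gammaCoeff m i j : MvPolynomial (Fin 3) ℤ) * (X 0 * X 1) ^ j *
        (X 0 + X 1) ^ (M + 1 - i - 2 * j) := by
  have hterm : ∀ i j, X 2 ^ i * ((gammaCoeff m i j : MvPolynomial (Fin 3) ℤ) * (X 0 * X 1) ^ j *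
      (X 0 + X 1) ^ (M + 1 - i - 2 * j)) = ∑ w ∈ stirlingPerms m,
        if sddes w = 0 ∧ fdesp w = 0 ∧ mdup w = i ∧ ascpp w = j then
          X 2 ^ i * ((X 0 * X 1) ^ j * (X 0 + X 1) ^ (M + 1 - i - 2 * j)) else 0 := by
    intro i j
    rw [← Finset.sum_filter, Finset.sum_const, nsmul_eq_mul, gammaCoeff]
    ring
  simp only [Finset.mul_sum, hterm]
  rw [stirlingPoly_eq_collapse m hn hm]
  have hswap : ∀ i, ∑ j ∈ Finset.Icc 1 ((M + 1 - i) / 2), ∑ w ∈ stirlingPerms m,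
      (if sddes w = 0 ∧ fdesp w = 0 ∧ mdup w = i ∧ ascpp w = j then
        X 2 ^ i * ((X 0 * X 1) ^ j * (X 0 + X 1) ^ (M + 1 - i - 2 * j)) else 0 :
          MvPolynomial (Fin 3) ℤ)
      = ∑ w ∈ stirlingPerms m, ∑ j ∈ Finset.Icc 1 ((M + 1 - i) / 2),
      (if sddes w = 0 ∧ fdesp w = 0 ∧ mdup w = i ∧ ascpp w = j then
        X 2 ^ i * ((X 0 * X 1) ^ j * (X 0 + X 1) ^ (M + 1 - i - 2 * j)) else 0) :=
    fun i => Finset.sum_comm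
  simp only [hswap]
  rw [Finset.sum_comm]
  refine Finset.sum_congr rfl fun w hw => ?_
  rw [collapse_moveWeight]
  split_ifs with h
  · have hlen := (length_of_mem_stirlingPerms hw).trans hM
    have hgaps := (mem_stirlingPerms.1 hw).2.card_neutralGap
      fun x hx => (bounds_of_mem_stirlingPerms hw hx).1
    have hpos : 0 < ascpp w := by
      obtain ⟨n, rfl⟩ : ∃ c, n = c + 1 := ⟨n - 1, by omega⟩
      exact ascpp_pos_of_mem_stirlingPerms (hm _) hw
    rw [Finset.sum_eq_single (mdup w), Finset.sum_eq_single (ascpp w), if_pos ⟨h.1, h.2, rfl, rfl⟩,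
      hlen]
    · exact fun j _ hj => if_neg fun h' => hj h'.2.2.2.symm
    · intro hj
      refine absurd (Finset.mem_Icc.2 ⟨hpos, ?_⟩) hj
      omega
    · exact fun i _ hi => Finset.sum_eq_zero fun j _ => if_neg fun h' => hi h'.2.2.1.symm
    · intro hi
      refine absurd (Finset.mem_range.2 ?_) hi
      omega
  · symm
    exact Finset.sum_eq_zero fun i _ => Finset.sum_eq_zero fun j _ =>
      if_neg fun h' => h ⟨h'.1, h'.2.1⟩

/-! ### Gamma-positivity -/

lemma isHomogeneousGammaPositive_zero : IsHomogeneousGammaPositive 0 :=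
  ⟨0, isHomogeneous_zero _ _ _, fun _ => 0, fun _ => le_rfl, by simp⟩

lemma isHomogeneousGammaPositive_sum (d : ℕ) (γ : ℕ → ℕ) :
    IsHomogeneousGammaPositive (∑ j ∈ Finset.Icc 1 (d / 2),
      (γ j : MvPolynomial (Fin 2) ℤ) * (X 0 * X 1) ^ j * (X 0 + X 1) ^ (d - 2 * j)) := by
  -- The sum starts at `j = 1`, so the coefficient at `0` must be set to zero whatever `γ 0` is.
  refine ⟨d, ?_, fun j => if j = 0 then 0 else γ j, fun j => ?_, ?_⟩
  · refine IsHomogeneous.sum _ _ _ fun j hj => ?_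
    have hj := Finset.mem_Icc.1 hj
    have h0 : ((γ j : ℕ) : MvPolynomial (Fin 2) ℤ).IsHomogeneous 0 := by
      rw [← map_natCast (C : ℤ →+* MvPolynomial (Fin 2) ℤ)]
      exact isHomogeneous_C _ _
    have h1 := ((isHomogeneous_X ℤ (0 : Fin 2)).mul (isHomogeneous_X ℤ (1 : Fin 2))).pow j
    have h2 := ((isHomogeneous_X ℤ (0 : Fin 2)).add (isHomogeneous_X ℤ (1 : Fin 2))).pow (d - 2 * j)
    convert (h0.mul h1).mul h2 using 1
    omega
  · dsimp only
    split_ifs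
    · exact le_rfl
    · exact Int.natCast_nonneg _
  · have hrange : Finset.range (d / 2 + 1) = insert 0 (Finset.Icc 1 (d / 2)) := by
      ext j
      simp only [Finset.mem_range, Finset.mem_insert, Finset.mem_Icc]
      omega
    rw [hrange, Finset.sum_insert (by simp), map_sum]
    simp only [if_true, map_zero, zero_mul, zero_add]
    refine Finset.sum_congr rfl fun j hj => ?_
    have hj := (Finset.mem_Icc.1 hj).1
    rw [if_neg (by omega)]
    simp [add_comm]

lemma isPartialGammaPositive_sum (M : ℕ) (s : ℕ → MvPolynomial (Fin 2) ℤ)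
    (hs : ∀ i, IsHomogeneousGammaPositive (s i)) :
    IsPartialGammaPositive (∑ i ∈ Finset.range M, X 2 ^ i * rename Fin.castSucc (s i)) := by
  refine ⟨∑ i ∈ Finset.range M, Finsupp.single i (s i), ?_, fun i => ?_⟩
  · rw [← Finsupp.sum_finsetSum_index]
    · refine Finset.sum_congr rfl fun i _ => ?_
      rw [Finsupp.sum_single_index (by simp), mul_comm]
    · simp
    · intro i a b
      rw [map_add, add_mul]
  · rw [Finsupp.finsetSum_apply]
    simp only [Finsupp.single_apply, Finset.sum_ite_eq']
    split_ifs
    · exact hs i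
    · exact isHomogeneousGammaPositive_zero

end GenStirling

theorem theorem1 (n : ℕ) (hn : 0 < n) (m : Fin n → ℕ) (hm : ∀ k, 0 < m k)
    (M : ℕ) (hM : ∑ k, m k = M) :
    GenStirling.IsPartialGammaPositive (GenStirling.stirlingPoly m) ∧
    GenStirling.stirlingPoly m =
      ∑ i ∈ Finset.range M, MvPolynomial.X 2 ^ i *
        ∑ j ∈ Finset.Icc 1 ((M + 1 - i) / 2),
          (GenStirling.gammaCoeff m i j : MvPolynomial (Fin 3) ℤ) *
            (MvPolynomial.X 0 * MvPolynomial.X 1) ^ j *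
            (MvPolynomial.X 0 + MvPolynomial.X 1) ^ (M + 1 - i - 2 * j) := by
  have h := GenStirling.stirlingPoly_eq_sum_gammaCoeff hn m hm hM
  refine ⟨?_, h⟩
  have hp := GenStirling.isPartialGammaPositive_sum M _ fun i =>
    GenStirling.isHomogeneousGammaPositive_sum (M + 1 - i) (GenStirling.gammaCoeff m i)
  rw [h]
  convert hp using 4 with i hi
  simp
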